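/- There is an absolute constant $C$ such that the following holds. Let $S\subset\mathbb R^d$ be a regular simplex of unit side length with vertices $q_0,\dots,q_d$, let $P\subseteq S$ be a convex body (a nonempty compact convex set) of diameter $1$, and let $0<\varepsilon<1$. A nested barycentric system over $S$ consists of an ordered list of points $q_0,\dots,q_t$ and a division of $S$ into simplices with vertices among them. It starts with $q_0,\dots,q_d$ and the single simplex $S$; a step appends a new point in the interior of one of the current simplices and replaces that simplex by the $d+1$ simplices obtained by exchanging one of its vertices for the new point. The embedding $\phi_t(x)\in\mathbb R^{t+1}$ of $x\in S$ has, at the indices of the vertices of a current simplex containing $x$, the barycentric coefficients of $x$ in that simplex, and zeros elsewhere. The $s$-stage uniform subdivision of $S$ is the nested barycentric system obtained by performing $s$ times the following stage: every simplex present at the start of the stage is split at its barycenter. Then there are an integer $s\ge 0$ with $$s\le 2^{Cd}\,\ln^2(1/\varepsilon)$$ and a weight vector $w\in\mathbb R^{t+1}$, where $q_0,\dots,q_t$ are the points of the $s$-stage uniform subdivision $B_t$ of $S$, such that the set $$\tilde P=\{x\in S : w\cdot\phi_t(x)\ge 0\}$$ satisfies 1. $\operatorname{vol}(\tilde P\setminus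 P)<\varepsilon\operatorname{vol}(S)$; 2. $\tilde P^{(-\varepsilon)}\subseteq P\subseteq\tilde P$, where $X^{(-\varepsilon)}$ denotes the set of all $p\in X$ such that the closed ball of radius $\varepsilon$ centered at $p$ is contained in $X$. -/

import Mathlib

open MeasureTheory

noncomputable section

/-- A barycentric coordinate system in `ℝ^d`: an ordered list of coordinate points
`pt 0, …, pt (size - 1)` (later values of `pt` are irrelevant), together with the simplices into
which space is currently divided; a simplex is given by the indices of its `d + 1` vertices. -/
structure NBCS (d : ℕ) where
  size : ℕ
  pt : ℕ → EuclideanSpace ℝ (Fin d)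
  cells : List (Fin (d + 1) → ℕ)

namespace NBCS

variable {d : ℕ}

/-- The initial system: the coordinate points are the vertices `q 0, …, q d`, and the only simplex
is the one that they span. -/
def init (q : Fin (d + 1) → EuclideanSpace ℝ (Fin d)) : NBCS d where
  size := d + 1
  pt := fun k => if h : k < d + 1 then q ⟨k, h⟩ else 0
  cells := [fun i => (i : ℕ)]

/-- Append the coordinate point `p` and split the simplex `σ` at `p`: the simplex `σ` is replaced
by the `d + 1` simplices obtained from `σ` by exchanging one of its vertices for `p`. -/
def split (B : NBCS d) (σ : Fin (d + 1) → ℕ) (p : EuclideanSpace ℝ (Fin d)) : NBCS d where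
  size := B.size + 1
  pt := Function.update B.pt B.size p
  cells := B.cells.erase σ ++ List.ofFn (fun i => Function.update σ i B.size)

/-- The nested barycentric systems over the simplex with vertices `q`: those obtained from the
initial system by repeatedly splitting a simplex at a point inside it, that is, at a point all of
whose barycentric coefficients in that simplex are positive. -/
inductive IsNested (q : Fin (d + 1) → EuclideanSpace ℝ (Fin d)) : NBCS d → Prop
  | init : IsNested q (init q)
  | split (B : NBCS d) (σ : Fin (d + 1) → ℕ) (β : Fin (d + 1) → ℝ) :
      IsNested q B → σ ∈ B.cells → (∀ i, 0 < β i) → ∑ i, β i = 1 →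
      IsNested q (B.split σ (∑ i, β i • B.pt (σ i)))

/-- The barycenter of a simplex of the system. -/
def barycenter (B : NBCS d) (σ : Fin (d + 1) → ℕ) : EuclideanSpace ℝ (Fin d) :=
  ((d : ℝ) + 1)⁻¹ • ∑ i, B.pt (σ i)

/-- Split the simplex `σ` at its barycenter. -/
def splitBarycenter (B : NBCS d) (σ : Fin (d + 1) → ℕ) : NBCS d :=
  B.split σ (B.barycenter σ)

/-- One stage of uniform subdivision: each simplex present at the start of the stage is split
(once) at its barycenter. -/
def uniformStage (B : NBCS d) : NBCS d :=
  B.cells.foldl splitBarycenter B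

/-- The `s`-stage uniform subdivision of the simplex with vertices `q`. -/
def uniformSubdivision (q : Fin (d + 1) → EuclideanSpace ℝ (Fin d)) : ℕ → NBCS d
  | 0 => init q
  | s + 1 => (uniformSubdivision q s).uniformStage

/-- `v` is the vector of coefficients of the point `x`: the coordinates of `v` that belong to the
vertices of a simplex of the system containing `x` are the barycentric coefficients of `x` in that
simplex, and all other coordinates of `v` are zero. -/
def IsEmbedding (B : NBCS d) (x : EuclideanSpace ℝ (Fin d)) (v : Fin B.size → ℝ) : Prop :=
  ∃ σ ∈ B.cells, ∃ α : Fin (d + 1) → ℝ,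
    (∀ i, 0 ≤ α i) ∧ ∑ i, α i = 1 ∧ ∑ i, α i • B.pt (σ i) = x ∧
    ∀ k : Fin B.size, v k = ∑ i, if σ i = (k : ℕ) then α i else 0

open Classical in
/-- The embedding `φ` of the system. For a nested system over a nondegenerate simplex, a point of
that simplex has exactly one vector of coefficients: two simplices of the system meet in a common
face. Outside of that simplex the value is irrelevant. -/
def embed (B : NBCS d) (x : EuclideanSpace ℝ (Fin d)) : Fin B.size → ℝ :=
  if h : ∃ v, B.IsEmbedding x v then h.choose else 0

/-- The region `{x ∈ S : w · φ(x) ≥ 0}` described by the weights `w` in the simplex `S`. -/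
def region (B : NBCS d) (S : Set (EuclideanSpace ℝ (Fin d))) (w : Fin B.size → ℝ) :
    Set (EuclideanSpace ℝ (Fin d)) :=
  {x ∈ S | 0 ≤ w ⬝ᵥ B.embed x}

theorem mem_cells_split_of_ne {B : NBCS d} {σ τ : Fin (d + 1) → ℕ}
    {p : EuclideanSpace ℝ (Fin d)} (h : τ ∈ B.cells) (hne : τ ≠ σ) :
    τ ∈ (B.split σ p).cells :=
  List.mem_append_left _ ((List.mem_erase_of_ne hne).2 h)

theorem IsNested.splitBarycenter {q : Fin (d + 1) → EuclideanSpace ℝ (Fin d)} {B : NBCS d}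
    (h : IsNested q B) {σ : Fin (d + 1) → ℕ} (hσ : σ ∈ B.cells) :
    IsNested q (B.splitBarycenter σ) := by
  have h1 := IsNested.split B σ (fun _ => ((d : ℝ) + 1)⁻¹) h hσ (fun _ => by positivity)
    (by simp [mul_inv_cancel₀ (show (d : ℝ) + 1 ≠ 0 by positivity)])
  rwa [← Finset.smul_sum] at h1

/-- The simplices of the system are pairwise distinct and use existing indices only. -/
def Valid (B : NBCS d) : Prop :=
  B.cells.Nodup ∧ ∀ σ ∈ B.cells, ∀ i, σ i < B.size

theorem Valid.split {B : NBCS d} (h : B.Valid) {σ : Fin (d + 1) → ℕ} (hσ : σ ∈ B.cells)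
    (p : EuclideanSpace ℝ (Fin d)) : (B.split σ p).Valid := by
  obtain ⟨h1, h2⟩ := h
  refine ⟨?_, ?_⟩
  · refine List.Nodup.append (h1.erase σ) ?_ ?_
    · rw [List.nodup_ofFn]
      intro i j hij
      by_contra hne
      have h3 := congrFun hij i
      simp only [Function.update_self, Function.update_of_ne hne] at h3
      exact absurd (h2 σ hσ i) (by omega)
    · intro τ h3 h4
      obtain ⟨i, rfl⟩ := (List.mem_ofFn' _ _).1 h4
      have h5 := h2 _ (List.mem_of_mem_erase h3) i
      simp at h5
  · intro τ hτ i
    rcases List.mem_append.1 hτ with h3 | h3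
    · exact Nat.lt_succ_of_lt (h2 τ (List.mem_of_mem_erase h3) i)
    · obtain ⟨j, rfl⟩ := (List.mem_ofFn' _ _).1 h3
      have h4 := h2 σ hσ i
      rcases eq_or_ne i j with rfl | hne
      · simp [NBCS.split]
      · simp only [Function.update_of_ne hne, NBCS.split]
        omega

theorem foldl_splitBarycenter {q : Fin (d + 1) → EuclideanSpace ℝ (Fin d)}
    (L : List (Fin (d + 1) → ℕ)) (hL : L.Nodup) (B : NBCS d) (hsub : ∀ σ ∈ L, σ ∈ B.cells)
    (hB : B.Valid) (hN : IsNested q B) :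
    (L.foldl NBCS.splitBarycenter B).Valid ∧ IsNested q (L.foldl NBCS.splitBarycenter B) := by
  induction L generalizing B with
  | nil => exact ⟨hB, hN⟩
  | cons σ L ih =>
    have hσ : σ ∈ B.cells := hsub σ (by simp)
    rw [List.nodup_cons] at hL
    refine ih hL.2 _ (fun τ hτ => ?_) (hB.split hσ _) (hN.splitBarycenter hσ)
    exact mem_cells_split_of_ne (hsub τ (by simp [hτ])) (fun h => hL.1 (h ▸ hτ))

/-- Uniform subdivision yields nested barycentric systems. -/
theorem isNested_uniformSubdivision (q : Fin (d + 1) → EuclideanSpace ℝ (Fin d)) (s : ℕ) :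
    IsNested q (uniformSubdivision q s) := by
  have h : (uniformSubdivision q s).Valid ∧ IsNested q (uniformSubdivision q s) := by
    induction s with
    | zero =>
      exact ⟨⟨by simp [uniformSubdivision, init],
        by simpa [uniformSubdivision, init] using fun i : Fin (d + 1) => Nat.le_of_lt_succ i.isLt⟩,
        .init⟩
    | succ s ih => exact foldl_splitBarycenter _ ih.1.1 _ (fun _ h => h) ih.1 ih.2
  exact h.2

end NBCS

/-- `X^(-ε)`: the points of `X` whose closed `ε`-ball is contained in `X`. -/
def innerParallel {d : ℕ} (X : Set (EuclideanSpace ℝ (Fin d))) (ε : ℝ) :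
    Set (EuclideanSpace ℝ (Fin d)) :=
  {p ∈ X | Metric.closedBall p ε ⊆ X}

end

/-!
# Approximation of convex bodies by nested barycentric coordinates

The weights are simple. In the subdivision with `s + 1` stages, a coordinate point gets the weight
`-1` if all simplices having it as a vertex miss `P`, and the weight `0` otherwise
(`NBCS.missWeight`). A simplex that meets `P` has weights `0` only, so `P` lies in the region.
Conversely, let `x` be a point of the region outside of `P` and not on a facet of a simplex. All
weights of the simplex containing `x` vanish, in particular the one of its newest vertex, the
barycenter of a simplex `σ` of stage `s`; as all simplices with this vertex are parts of `σ`, the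
simplex `σ` contains both `x` and a point of `P`. Hence `σ` is long or `x` is close to `P`
(`NBCS.measure_region_missWeight_diff_le`). Lengths are measured by the sup norm of the barycentric
coordinates with respect to the large simplex.

* Long simplices: splitting at the barycenter produces children of equal volume, and the sum of the
  mutual distances of the vertices is multiplied on average by at most `1 - 2 / (d + 1)²`
  (`sum_spread_update_le`). So it decays exponentially in the number of stages, and Markov's
  inequality bounds the total volume of the long simplices (`NBCS.measure_long_le`).
* Points close to `P`: they are reached from `P` by moving successively along short multiples of
  the edge directions at a vertex. Moving a convex set `K` along a short segment `[0, e / n]` adds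
  a set with `n` disjoint translates in `K + [0, e]`, so the added volume is small
  (`measure_add_segment_diff_le`, `measure_shell_le`).

The statement about the inner parallel body follows from the one about volumes, applied with the
error `ε ^ d / 2`: a ball in the region with center outside of `P` has one half disjoint from `P`,
and the large simplex is contained in a unit ball (`innerParallel_subset_of_measure_lt`).

The number of stages is polynomial in `d` and linear in `1 + ln (1 / ε)`, which is within the
required bound unless `ε` is exponentially close to `1`. In that case the bound
may force `s = 0`. Either `P` is nearly the whole simplex, and the zero weights do; or `P` misses a point deep inside
the simplex, and a halfspace separating this point from `P` cuts off enough volume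
(`NBCS.exists_weight_zero_stages`). The inner parallel body is then empty.
-/

/-! ### Volumes of simplices -/

theorem mem_convexHull_range_iff {ι E : Type*} [Fintype ι] [AddCommGroup E] [Module ℝ E]
    {v : ι → E} {x : E} :
    x ∈ convexHull ℝ (Set.range v) ↔
      ∃ α : ι → ℝ, (∀ i, 0 ≤ α i) ∧ ∑ i, α i = 1 ∧ ∑ i, α i • v i = x := by
  constructor
  · intro hx
    rw [convexHull_range_eq_exists_affineCombination] at hx
    obtain ⟨s, w, h0, h1, rfl⟩ := hx
    classical
    refine ⟨fun i => if i ∈ s then w i else 0, fun i => ?_, ?_, ?_⟩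
    · dsimp only
      split_ifs with h
      exacts [h0 i h, le_rfl]
    · simpa using h1
    · rw [s.affineCombination_eq_linear_combination _ _ h1]
      simp [ite_smul]
  · rintro ⟨α, h0, h1, rfl⟩
    exact (convex_convexHull ℝ _).sum_mem (fun i _ => h0 i) h1
      (fun i _ => subset_convexHull ℝ _ ⟨i, rfl⟩)

theorem convexHull_range_update_subset {ι E : Type*} [DecidableEq ι] [AddCommGroup E] [Module ℝ E]
    {v : ι → E} {p : E} (hp : p ∈ convexHull ℝ (Set.range v)) (i : ι) :
    convexHull ℝ (Set.range (Function.update v i p)) ⊆ convexHull ℝ (Set.range v) := by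
  refine convexHull_min ?_ (convex_convexHull ℝ _)
  rintro _ ⟨j, rfl⟩
  rcases eq_or_ne j i with rfl | h
  · simpa using hp
  · rw [Function.update_of_ne h]
    exact subset_convexHull ℝ _ ⟨j, rfl⟩

section Volume

variable {E : Type*} [NormedAddCommGroup E] [NormedSpace ℝ E] [FiniteDimensional ℝ E]
  [MeasurableSpace E] [BorelSpace E] (μ : Measure E) [μ.IsAddHaarMeasure]

/-- The volume of an affine image; the translation part does not matter. -/
theorem measure_image_affineMap (A : E →ᵃ[ℝ] E) (s : Set E) :
    μ (A '' s) = ENNReal.ofReal |LinearMap.det A.linear| * μ s := by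
  have h : A '' s = (fun y => A 0 + y) '' (A.linear '' s) := by
    rw [Set.image_image]
    refine Set.image_congr fun x _ => ?_
    rw [add_comm]
    exact congrFun (AffineMap.decomp A) x
  rw [h, Set.image_add_left, measure_preimage_add, Measure.addHaar_image_linearMap]

/-- Moving one vertex of a simplex scales the volume by the barycentric coefficient of the new
vertex at the old one. The affine map that moves this vertex only has a transvection as its linear
part. -/
theorem measure_convexHull_update {ι : Type*} [Fintype ι] [DecidableEq ι]
    (hι : Fintype.card ι = Module.finrank ℝ E + 1) (v : ι → E) (i : ι) {β : ι → ℝ}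
    (h0 : ∀ j, 0 ≤ β j) (h1 : ∑ j, β j = 1) :
    μ (convexHull ℝ (Set.range (Function.update v i (∑ j, β j • v j)))) =
      ENNReal.ofReal (β i) * μ (convexHull ℝ (Set.range v)) := by
  by_cases hv : AffineIndependent ℝ v
  · have htop : affineSpan ℝ (Set.range v) = ⊤ :=
      hv.affineSpan_eq_top_iff_card_eq_finrank_add_one.2 hι
    let b : AffineBasis ι ℝ E := ⟨v, hv, htop⟩
    have hb : ∀ j, b j = v j := fun j => rfl
    set p := ∑ j, β j • v j with hp
    have hcp : b.coord i p = β i := by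
      have : p = Finset.univ.affineCombination ℝ b β := by
        rw [Finset.univ.affineCombination_eq_linear_combination _ _ h1]; rfl
      rw [this, b.coord_apply_combination_of_mem (Finset.mem_univ i) h1]
    let A : E →ᵃ[ℝ] E := AffineMap.id ℝ E +
      (LinearMap.toSpanSingleton ℝ E (p - v i)).toAffineMap.comp (b.coord i)
    have hA : ∀ x, A x = x + b.coord i x • (p - v i) := fun x => rfl
    have hAv : Function.update v i p = A ∘ v := by
      funext j
      rw [Function.comp_apply, hA, ← hb j, b.coord_apply]
      rcases eq_or_ne j i with rfl | h
      · simp [hb]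
      · simp [h, h.symm, hb]
    have hdet : LinearMap.det A.linear = β i := by
      have : A.linear = LinearMap.transvection (b.coord i).linear (p - v i) := by
        ext x; rfl
      rw [this, LinearMap.transvection.det]
      have h2 : (b.coord i).linear (p - v i) = b.coord i p - b.coord i (v i) := by
        simpa using (b.coord i).linearMap_vsub p (v i)
      rw [h2, hcp, ← hb i, b.coord_apply]
      simp
    rw [hAv, Set.range_comp, ← AffineMap.image_convexHull, measure_image_affineMap, hdet,
      abs_of_nonneg (h0 i)]
  · have hne : affineSpan ℝ (Set.range v) ≠ ⊤ := by
      intro htop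
      refine hv ((affineIndependent_iff_finrank_vectorSpan_eq ℝ v hι).2 ?_)
      have := congrArg AffineSubspace.direction htop
      rw [direction_affineSpan, AffineSubspace.direction_top] at this
      rw [this, finrank_top]
    have hz : μ (convexHull ℝ (Set.range v)) = 0 :=
      measure_mono_null (convexHull_subset_affineSpan _) (Measure.addHaar_affineSubspace μ _ hne)
    rw [hz, mul_zero]
    exact measure_mono_null (convexHull_range_update_subset
      (mem_convexHull_range_iff.2 ⟨β, h0, h1, rfl⟩) i) hz

/-- The facets of a simplex are null sets. -/
theorem measure_facet_eq_zero {ι : Type*} [Fintype ι] [Nontrivial ι]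
    (hι : Fintype.card ι = Module.finrank ℝ E + 1) (v : ι → E) (i : ι) :
    μ {x | ∃ α : ι → ℝ, (∀ j, 0 ≤ α j) ∧ ∑ j, α j = 1 ∧ ∑ j, α j • v j = x ∧ α i = 0} = 0 := by
  classical
  obtain ⟨k, hk⟩ := exists_ne i
  have h := measure_convexHull_update μ hι v i (β := Pi.single k 1)
    (fun j => by by_cases h : j = k <;> simp [h]) (by simp)
  simp only [Pi.single_apply, hk.symm, if_false, ENNReal.ofReal_zero, zero_mul] at h
  refine measure_mono_null ?_ h
  rintro x ⟨α, h0, h1, rfl, hi⟩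
  refine mem_convexHull_range_iff.2 ⟨α, h0, h1, Finset.sum_congr rfl fun j _ => ?_⟩
  rcases eq_or_ne j i with rfl | h
  · simp [hi]
  · rw [Function.update_of_ne h]

/-- Moving several vertices of a simplex towards one fixed vertex. -/
theorem measure_convexHull_move {ι : Type*} [Fintype ι] [DecidableEq ι]
    (hι : Fintype.card ι = Module.finrank ℝ E + 1) (v : ι → E) (m : ι) {θ : ι → ℝ}
    (h0 : ∀ j, 0 ≤ θ j) (h1 : ∀ j, θ j ≤ 1) (J : Finset ι) (hm : m ∉ J) :
    μ (convexHull ℝ (Set.range fun j => if j ∈ J then θ j • v j + (1 - θ j) • v m else v j)) =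
      ENNReal.ofReal (∏ j ∈ J, θ j) * μ (convexHull ℝ (Set.range v)) := by
  induction J using Finset.induction_on with
  | empty => simp
  | insert i J hi ih =>
    have hm' : m ∉ J := fun h => hm (Finset.mem_insert_of_mem h)
    have hmi : m ≠ i := fun h => hm (h ▸ Finset.mem_insert_self _ _)
    have h2 := measure_convexHull_update μ hι
      (fun j => if j ∈ J then θ j • v j + (1 - θ j) • v m else v j) i
      (β := Pi.single i (θ i) + Pi.single m (1 - θ i))
      (fun j => by
        have := h0 i; have := h1 i
        refine add_nonneg ?_ ?_ <;> rw [Pi.single_apply] <;> split_ifs <;> linarith)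
      (by simp [Finset.sum_add_distrib])
    have h3 : (fun j => if j ∈ insert i J then θ j • v j + (1 - θ j) • v m else v j) =
        Function.update (fun j => if j ∈ J then θ j • v j + (1 - θ j) • v m else v j) i
          (∑ j, ((Pi.single i (θ i) + Pi.single m (1 - θ i) : ι → ℝ) j) •
            (if j ∈ J then θ j • v j + (1 - θ j) • v m else v j)) := by
      funext j
      rcases eq_or_ne j i with rfl | h
      · have h4 : ∀ f : ι → E, ∑ k, (Pi.single j (θ j) + Pi.single m (1 - θ j) : ι → ℝ) k • f k =
            θ j • f j + (1 - θ j) • f m := fun f => by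
          simp only [Pi.add_apply, add_smul, Finset.sum_add_distrib, Pi.single_apply, ite_smul,
            zero_smul, Finset.sum_ite_eq', Finset.mem_univ, if_true]
        rw [h4]
        simp [hi, hm']
      · simp [h]
    rw [h3, h2, ih hm', Finset.prod_insert hi, ENNReal.ofReal_mul (h0 i), mul_assoc]
    congr 2
    simp [hmi.symm]

end Volume

/-! ### Sweeping a convex set along segments -/

section Sweep

open scoped Pointwise

variable {E : Type*} [NormedAddCommGroup E] [NormedSpace ℝ E]

/-- The set `K` swept successively along the segments from `0` to `t • f`, for the vectors `f` of
a list. -/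
def sweep (t : ℝ) (K : Set E) : List E → Set E
  | [] => K
  | f :: L => sweep t (K + segment ℝ 0 (t • f)) L

theorem mem_add_segment {K : Set E} {e x : E} {t : ℝ} (ht : 0 ≤ t) :
    x ∈ K + segment ℝ 0 (t • e) ↔ ∃ c, 0 ≤ c ∧ c ≤ t ∧ x - c • e ∈ K := by
  constructor
  · rintro ⟨y, hy, z, hz, rfl⟩
    rw [segment_eq_image] at hz
    obtain ⟨a, ⟨ha0, ha1⟩, rfl⟩ := hz
    refine ⟨a * t, by positivity, by nlinarith, ?_⟩
    simpa [mul_smul] using hy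
  · rintro ⟨c, h0, h1, hx⟩
    refine ⟨_, hx, c • e, ?_, by simp⟩
    rcases ht.eq_or_lt with rfl | ht
    · obtain rfl : c = 0 := le_antisymm h1 h0
      simp
    · rw [segment_eq_image]
      refine ⟨c / t, ⟨by positivity, (div_le_one ht).2 h1⟩, ?_⟩
      simp only [smul_zero, zero_add, smul_smul]
      rw [div_mul_cancel₀ _ ht.ne']

theorem IsCompact.add_segment {K : Set E} (hK : IsCompact K) (e : E) :
    IsCompact (K + segment ℝ 0 e) := by
  refine hK.add ?_
  rw [segment_eq_image_lineMap]
  exact isCompact_Icc.image (by fun_prop)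

theorem IsCompact.sweep {K : Set E} (hK : IsCompact K) (t : ℝ) (L : List E) :
    IsCompact (sweep t K L) := by
  induction L generalizing K with
  | nil => exact hK
  | cons f L ih => exact ih (hK.add_segment _)

theorem subset_sweep (t : ℝ) (K : Set E) (L : List E) : K ⊆ sweep t K L := by
  induction L generalizing K with
  | nil => exact subset_rfl
  | cons f L ih =>
    exact fun x hx => ih _ ⟨x, hx, 0, left_mem_segment ℝ _ _, add_zero x⟩

theorem sweep_mono {t : ℝ} {K K' : Set E} (h : K ⊆ K') (L : List E) :
    sweep t K L ⊆ sweep t K' L := by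
  induction L generalizing K K' with
  | nil => exact h
  | cons f L ih => exact ih (Set.add_subset_add_right h)

theorem add_segment_mono {t t' : ℝ} (h0 : 0 ≤ t) (h : t ≤ t') (K : Set E) (e : E) :
    K + segment ℝ 0 (t • e) ⊆ K + segment ℝ 0 (t' • e) := fun x hx => by
  obtain ⟨c, h1, h2, h3⟩ := (mem_add_segment h0).1 hx
  exact (mem_add_segment (h0.trans h)).2 ⟨c, h1, h2.trans h, h3⟩

theorem add_sum_mem_sweep {t : ℝ} (ht : 0 ≤ t) {m : ℕ} (f : Fin m → E) (c : Fin m → ℝ)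
    (h0 : ∀ i, 0 ≤ c i) (h1 : ∀ i, c i ≤ t) {K : Set E} {x : E} (hx : x ∈ K) :
    x + ∑ i, c i • f i ∈ sweep t K (List.ofFn f) := by
  induction m generalizing K x with
  | zero => simpa [sweep] using hx
  | succ m ih =>
    rw [List.ofFn_succ, Fin.sum_univ_succ, ← add_assoc]
    refine ih (fun i => f i.succ) (fun i => c i.succ) (fun i => h0 _) (fun i => h1 _) ?_
    exact (mem_add_segment ht).2 ⟨c 0, h0 0, h1 0, by simpa using hx⟩

variable [MeasurableSpace E] [BorelSpace E] (μ : Measure E) [μ.IsAddHaarMeasure]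

/-- Sweeping a convex set along a short segment adds little volume: the translates of the added
part by the multiples of the segment are pairwise disjoint, and they fit into the set swept along
the long segment. -/
theorem measure_add_segment_diff_le {K : Set E} (hK : IsCompact K) (hc : Convex ℝ K) (e : E)
    {n : ℕ} (hn : n ≠ 0) :
    n * μ ((K + segment ℝ 0 ((n : ℝ)⁻¹ • e)) \ K) ≤ μ (K + segment ℝ 0 ((1 : ℝ) • e)) := by
  have hn' : (0 : ℝ) < n := by positivity
  set t : ℝ := (n : ℝ)⁻¹ with ht
  have ht0 : 0 < t := by positivity
  set D := (K + segment ℝ 0 (t • e)) \ K with hD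
  have hDm : MeasurableSet D :=
    (hK.add_segment _).measurableSet.diff hK.measurableSet
  -- a point of `D` moved by a positive multiple of `t • e` leaves `D`, by convexity of `K`
  have key : ∀ x ∈ D, ∀ c, t ≤ c → x + c • e ∉ D := by
    rintro x ⟨hx1, hx2⟩ c hc' ⟨hy1, -⟩
    obtain ⟨a, ha0, ha1, ha⟩ := (mem_add_segment ht0.le).1 hx1
    obtain ⟨b, hb0, hb1, hb⟩ := (mem_add_segment ht0.le).1 hy1
    have ha' : 0 < a := lt_of_le_of_ne ha0 fun h => hx2 (by simpa [← h] using ha)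
    have hs : 0 < a + (c - b) := by linarith
    refine hx2 ?_
    have h := hc ha hb (a := (c - b) / (a + (c - b))) (b := a / (a + (c - b)))
      (div_nonneg (by linarith) hs.le) (by positivity) (by field_simp; ring)
    convert h using 1
    have e1 : x + c • e - b • e = x + (c - b) • e := by rw [sub_smul]; abel
    rw [e1, smul_sub, smul_add, smul_smul, smul_smul]
    have e2 : (c - b) / (a + (c - b)) * a = a / (a + (c - b)) * (c - b) := by ring
    rw [e2, sub_add_add_cancel, ← add_smul, ← add_div, add_comm (c - b) a, div_self hs.ne',
      one_smul]
  have hdisj : Pairwise (Function.onFun Disjoint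
      fun j : Fin n => (fun x => -(((j : ℕ) * t) • e) + x) ⁻¹' D) := by
    have aux : ∀ i j : Fin n, i < j → Disjoint ((fun x => -(((i : ℕ) * t) • e) + x) ⁻¹' D)
        ((fun x => -(((j : ℕ) * t) • e) + x) ⁻¹' D) := by
      intro i j hij
      rw [Set.disjoint_left]
      intro x hxi hxj
      refine key _ hxj (((j : ℕ) - (i : ℕ) : ℝ) * t) ?_ ?_
      · have : ((i : ℕ) : ℝ) + 1 ≤ (j : ℕ) := by exact_mod_cast hij
        nlinarith
      · have h : -(((i : ℕ) * t) • e) + x ∈ D := hxi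
        convert h using 1
        simp only [sub_mul, sub_smul]
        abel
    intro i j hij
    rcases lt_or_gt_of_ne hij with h | h
    exacts [aux i j h, (aux j i h).symm]
  have hsub : (⋃ j : Fin n, (fun x => -(((j : ℕ) * t) • e) + x) ⁻¹' D) ⊆
      K + segment ℝ 0 ((1 : ℝ) • e) := by
    refine Set.iUnion_subset fun j x hx => ?_
    obtain ⟨a, ha0, ha1, ha⟩ := (mem_add_segment ht0.le).1 hx.1
    refine (mem_add_segment zero_le_one).2 ⟨(j : ℕ) * t + a, by positivity, ?_, ?_⟩
    · have : ((j : ℕ) : ℝ) + 1 ≤ n := by exact_mod_cast j.2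
      calc ((j : ℕ) : ℝ) * t + a ≤ (((j : ℕ) : ℝ) + 1) * t := by linarith
        _ ≤ n * t := by gcongr
        _ = 1 := mul_inv_cancel₀ hn'.ne'
    · convert ha using 1
      simp only [add_smul]
      abel
  calc (n : ENNReal) * μ D = ∑ j : Fin n, μ ((fun x => -(((j : ℕ) * t) • e) + x) ⁻¹' D) := by
        simp [measure_preimage_add]
    _ = μ (⋃ j : Fin n, (fun x => -(((j : ℕ) * t) • e) + x) ⁻¹' D) := by
        rw [measure_iUnion hdisj (fun j => measurable_const_add _ hDm), tsum_fintype]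
    _ ≤ _ := measure_mono hsub

/-- Sweeping along a list of vectors: each step adds a set of measure at most `1 / n` times that of
the set swept along the full vectors. -/
theorem measure_sweep_diff_le {K : Set E} (hK : IsCompact K) (hc : Convex ℝ K) (L : List E)
    {n : ℕ} (hn : n ≠ 0) :
    n * μ (sweep (n : ℝ)⁻¹ K L \ K) ≤ L.length * μ (sweep 1 K L) := by
  have hn' : (0 : ℝ) < n := by positivity
  have hn1 : (n : ℝ)⁻¹ ≤ 1 := inv_le_one_of_one_le₀ (by exact_mod_cast Nat.one_le_iff_ne_zero.2 hn)
  induction L generalizing K with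
  | nil => simp [sweep]
  | cons f L ih =>
    set K' := K + segment ℝ 0 ((n : ℝ)⁻¹ • f) with hK'
    have h1 := ih (hK.add_segment _) (hc.add (convex_segment 0 ((n : ℝ)⁻¹ • f)))
    have h2 := measure_add_segment_diff_le μ hK hc f hn
    have h3 : μ (sweep 1 K' L) ≤ μ (sweep 1 K (f :: L)) :=
      measure_mono (sweep_mono (add_segment_mono (by positivity) hn1 K f) L)
    have h4 : μ (K + segment ℝ 0 ((1 : ℝ) • f)) ≤ μ (sweep 1 K (f :: L)) :=
      measure_mono (subset_sweep _ _ _)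
    calc n * μ (sweep (n : ℝ)⁻¹ K' L \ K)
        ≤ n * (μ (sweep (n : ℝ)⁻¹ K' L \ K') + μ (K' \ K)) := by
          gcongr
          refine (measure_mono ?_).trans (measure_union_le _ _)
          intro x hx
          by_cases h : x ∈ K'
          exacts [Or.inr ⟨h, hx.2⟩, Or.inl ⟨hx.1, h⟩]
      _ ≤ L.length * μ (sweep 1 K (f :: L)) + μ (sweep 1 K (f :: L)) := by
          rw [mul_add]
          exact add_le_add (h1.trans (by gcongr)) (h2.trans h4)
      _ = _ := by simp [add_mul]

end Sweep

/-! ### The neighborhood of a convex set in barycentric coordinates -/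

section Shell

open scoped Pointwise

variable {E : Type*} [NormedAddCommGroup E] [NormedSpace ℝ E]

theorem sweep_append (t : ℝ) (K : Set E) (L L' : List E) :
    sweep t K (L ++ L') = sweep t (sweep t K L) L' := by
  induction L generalizing K with
  | nil => rfl
  | cons f L ih => exact ih _

/-- Sweeping along one vector lowers an affine functional that varies by at most `1` along it by at
most `1`. -/
theorem neg_length_le_of_mem_sweep (g : E →ᵃ[ℝ] ℝ) {K : Set E} {r : ℝ} (hg : ∀ x ∈ K, r ≤ g x)
    (L : List E) (hL : ∀ f ∈ L, |g.linear f| ≤ 1) : ∀ x ∈ sweep 1 K L, r - L.length ≤ g x := by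
  induction L generalizing K r with
  | nil => simpa [sweep] using hg
  | cons f L ih =>
    have h := ih (K := K + segment ℝ 0 ((1 : ℝ) • f)) (r := r - 1) (fun x hx => ?_)
      (fun f hf => hL f (by simp [hf]))
    · intro x hx
      have := h x hx
      push_cast [List.length_cons]
      linarith
    · obtain ⟨c, h0, h1, h2⟩ := (mem_add_segment zero_le_one).1 hx
      have h3 := hg _ h2
      have h4 : g x = g (x - c • f) + c * g.linear f := by
        have := g.linearMap_vsub x (x - c • f)
        simp only [vsub_eq_sub, sub_sub_cancel, map_smul, smul_eq_mul] at this
        linarith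
      have h5 := (abs_le.1 (hL f (by simp))).1
      nlinarith

variable {ι : Type*} [Fintype ι]

/-- The sup distance of the barycentric coordinates with respect to an affine basis. -/
noncomputable def coordDist (b : AffineBasis ι ℝ E) (x y : E) : ℝ :=
  dist (fun i => b.coord i x) (fun i => b.coord i y)

variable {m : ℕ}

/-- The directions of the edges of a simplex at its first vertex, and their opposites. -/
def edgeDirs (b : AffineBasis (Fin (m + 1)) ℝ E) : List E :=
  List.ofFn (fun i => b i - b 0) ++ List.ofFn (fun i => b 0 - b i)

/-- Points near `K` are swept: the displacement `x - p` is a combination of edge directions, whose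
positive and negative coefficients are treated separately. -/
theorem mem_sweep_edgeDirs (b : AffineBasis (Fin (m + 1)) ℝ E) {K : Set E} {x p : E} {t : ℝ}
    (hp : p ∈ K) (h : coordDist b x p ≤ t) : x ∈ sweep t K (edgeDirs b) := by
  have ht : 0 ≤ t := dist_nonneg.trans h
  have hi : ∀ i, |b.coord i x - b.coord i p| ≤ t := fun i => by
    simpa [Real.dist_eq] using (dist_le_pi_dist (fun i => b.coord i x) _ i).trans h
  set a : Fin (m + 1) → ℝ := fun i => b.coord i x - b.coord i p with ha
  have hs : ∑ i, a i = 0 := by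
    rw [ha, Finset.sum_sub_distrib, b.sum_coord_apply_eq_one, b.sum_coord_apply_eq_one, sub_self]
  have hx : x = p + ∑ i, (max (a i) 0) • (b i - b 0) + ∑ i, (max (-a i) 0) • (b 0 - b i) := by
    have h1 : ∀ i, (max (a i) 0) • (b i - b 0) + (max (-a i) 0) • (b 0 - b i) =
        a i • b i - a i • b 0 := fun i => by
      rw [← neg_sub (b i) (b 0), smul_neg, ← sub_eq_add_neg, ← sub_smul, ← smul_sub]
      congr 1
      rcases le_total (a i) 0 with h | h
      · rw [max_eq_right h, max_eq_left (by linarith)]; ring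
      · rw [max_eq_left h, max_eq_right (by linarith)]; ring
    rw [add_assoc, ← Finset.sum_add_distrib, Finset.sum_congr rfl (fun i _ => h1 i),
      Finset.sum_sub_distrib, ← Finset.sum_smul, hs, zero_smul, sub_zero]
    simp only [ha, sub_smul, Finset.sum_sub_distrib]
    rw [b.linear_combination_coord_eq_self, b.linear_combination_coord_eq_self]
    abel
  rw [edgeDirs, sweep_append, hx]
  refine add_sum_mem_sweep ht _ _ (fun i => le_max_right _ _) (fun i => max_le ?_ ht) ?_
  · exact (neg_le_abs _).trans (hi i)
  · exact add_sum_mem_sweep ht _ _ (fun i => le_max_right _ _)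
      (fun i => max_le ((le_abs_self _).trans (hi i)) ht) hp

variable [FiniteDimensional ℝ E] [MeasurableSpace E] [BorelSpace E] (μ : Measure E)
  [μ.IsAddHaarMeasure]

/-- A simplex inflated until its barycentric coordinates may drop to `-2(m + 1)` has volume at most
`(2(m + 1)² + 1)^m` times that of the simplex: a homothety at the barycenter maps it back. -/
theorem measure_inflated_simplex_le (hm : Module.finrank ℝ E = m)
    (b : AffineBasis (Fin (m + 1)) ℝ E) :
    μ {x | ∀ i, -(2 * (m + 1) : ℝ) ≤ b.coord i x} ≤
      ((2 * (m + 1) ^ 2 + 1) ^ m : ℕ) * μ (convexHull ℝ (Set.range b)) := by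
  set U := {x | ∀ i, -(2 * (m + 1) : ℝ) ≤ b.coord i x}
  set R : ℝ := 2 * (m + 1) ^ 2 + 1 with hR
  have hR0 : 0 < R := by positivity
  let c := Finset.univ.centroid ℝ b
  have hc : ∀ i, b.coord i c = ((m : ℝ) + 1)⁻¹ := fun i => by
    rw [show c = Finset.univ.centroid ℝ b from rfl, b.coord_apply_centroid (Finset.mem_univ i)]
    simp
  have hsub : AffineMap.homothety c R⁻¹ '' U ⊆ convexHull ℝ (Set.range b) := by
    rintro _ ⟨x, hx, rfl⟩
    rw [b.convexHull_eq_nonneg_coord]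
    intro i
    have hxi : -(2 * (m + 1) : ℝ) ≤ b.coord i x := hx i
    have h1 : b.coord i (AffineMap.homothety c R⁻¹ x) =
        (1 - R⁻¹) * ((m : ℝ) + 1)⁻¹ + R⁻¹ * b.coord i x := by
      rw [AffineMap.homothety_eq_lineMap, AffineMap.apply_lineMap, hc, AffineMap.lineMap_apply_ring]
    rw [h1]
    have h2 : (1 - R⁻¹) * ((m : ℝ) + 1)⁻¹ = R⁻¹ * (2 * (m + 1)) := by
      rw [hR]; field_simp; ring
    rw [h2, ← mul_add]
    exact mul_nonneg (by positivity) (by linarith)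
  have h := measure_mono (μ := μ) hsub
  rw [Measure.addHaar_image_homothety, hm, abs_of_nonneg (by positivity)] at h
  have hcast : (((2 * (m + 1) ^ 2 + 1) ^ m : ℕ) : ENNReal) = ENNReal.ofReal (R ^ m) := by
    rw [← ENNReal.ofReal_natCast]
    congr 1
    push_cast
    rfl
  rw [hcast]
  calc μ U = ENNReal.ofReal (R ^ m) * (ENNReal.ofReal (R⁻¹ ^ m) * μ U) := by
        rw [← mul_assoc, ← ENNReal.ofReal_mul (by positivity), ← mul_pow,
          mul_inv_cancel₀ hR0.ne', one_pow, ENNReal.ofReal_one, one_mul]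
    _ ≤ _ := by gcongr

/-- The set of points outside of a convex subset of a simplex, but within coordinate distance
`1 / n` of it, is small. -/
theorem measure_shell_le (hm : Module.finrank ℝ E = m) (b : AffineBasis (Fin (m + 1)) ℝ E)
    {K : Set E} (hK : IsCompact K) (hc : Convex ℝ K) (hKS : K ⊆ convexHull ℝ (Set.range b))
    {n : ℕ} (hn : n ≠ 0) :
    n * μ (sweep (n : ℝ)⁻¹ K (edgeDirs b) \ K) ≤
      (2 * (m + 1) * (2 * (m + 1) ^ 2 + 1) ^ m : ℕ) * μ (convexHull ℝ (Set.range b)) := by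
  have hlen : (edgeDirs b).length = 2 * (m + 1) := by simp [edgeDirs]; ring
  have hU : sweep 1 K (edgeDirs b) ⊆ {x | ∀ i, -(2 * (m + 1) : ℝ) ≤ b.coord i x} := by
    intro x hx i
    have hv : ∀ j k, (b.coord i).linear (b j - b k) = b.coord i (b j) - b.coord i (b k) :=
      fun j k => by simpa using (b.coord i).linearMap_vsub (b j) (b k)
    have h := neg_length_le_of_mem_sweep (b.coord i) (K := K) (r := 0) (fun y hy => ?_)
      (edgeDirs b) (fun f hf => ?_) x hx
    · rw [hlen] at h
      push_cast at h
      linarith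
    · have := hKS hy
      rw [b.convexHull_eq_nonneg_coord] at this
      exact this i
    · rcases List.mem_append.1 hf with h | h <;> obtain ⟨j, rfl⟩ := (List.mem_ofFn' _ _).1 h <;>
        rw [hv, b.coord_apply, b.coord_apply] <;> split_ifs <;> simp
  refine (measure_sweep_diff_le μ hK hc (edgeDirs b) hn).trans ?_
  rw [hlen, Nat.cast_mul (2 * (m + 1)), mul_assoc]
  gcongr
  exact (measure_mono hU).trans (measure_inflated_simplex_le μ hm b)

end Shell

/-! ### The spread of a simplex and random barycentric splitting -/

section Spread

variable {V ι : Type*} [Fintype ι]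

/-- The sum of all mutual distances of the points of a family. -/
noncomputable def spread [PseudoMetricSpace V] (y : ι → V) : ℝ := ∑ a, ∑ b, dist (y a) (y b)

theorem spread_nonneg [PseudoMetricSpace V] (y : ι → V) : 0 ≤ spread y :=
  Finset.sum_nonneg fun _ _ => Finset.sum_nonneg fun _ _ => dist_nonneg

variable [NormedAddCommGroup V] [NormedSpace ℝ V]

theorem dist_le_spread {y : ι → V} {x z : V} (hx : x ∈ convexHull ℝ (Set.range y))
    (hz : z ∈ convexHull ℝ (Set.range y)) : dist x z ≤ spread y := by
  obtain ⟨_, ⟨a, rfl⟩, _, ⟨b, rfl⟩, h⟩ := convexHull_exists_dist_ge2 hx hz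
  refine h.trans ?_
  calc dist (y a) (y b) ≤ ∑ b, dist (y a) (y b) :=
        Finset.single_le_sum (f := fun b => dist (y a) (y b)) (fun _ _ => dist_nonneg)
          (Finset.mem_univ b)
    _ ≤ spread y := Finset.single_le_sum (f := fun a => ∑ b, dist (y a) (y b))
          (fun _ _ => Finset.sum_nonneg fun _ _ => dist_nonneg) (Finset.mem_univ a)

/-- Exchanging a random vertex for the barycenter decreases the expected spread by a constant
factor. A pair of vertices survives unless one of them is exchanged, and the distances of the
barycenter to the vertices are bounded by averages of the distances among the vertices. -/
theorem sum_spread_update_le [DecidableEq ι] (y : ι → V) {N : ℝ} (hN : N = Fintype.card ι)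
    (hN0 : 0 < N) :
    ∑ i, spread (Function.update y i (N⁻¹ • ∑ j, y j)) ≤ (N - 2 / N) * spread y := by
  set c := N⁻¹ • ∑ j, y j with hc
  have hg : ∀ b, dist c (y b) ≤ N⁻¹ * ∑ a, dist (y a) (y b) := fun b => by
    have h1 : c - y b = N⁻¹ • ∑ a, (y a - y b) := by
      rw [Finset.sum_sub_distrib, Finset.sum_const, Finset.card_univ, smul_sub, hc,
        ← Nat.cast_smul_eq_nsmul ℝ, ← hN, inv_smul_smul₀ hN0.ne']
    rw [dist_eq_norm, h1, norm_smul, Real.norm_of_nonneg (by positivity)]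
    gcongr
    simpa only [dist_eq_norm] using norm_sum_le _ _
  have key : ∀ i a b, dist (Function.update y i c a) (Function.update y i c b) =
      dist (y a) (y b) + (if i = a then ((if a = b then 0 else dist c (y b)) - dist (y a) (y b))
        else 0) + (if i = b then ((if a = b then 0 else dist c (y a)) - dist (y a) (y b))
        else 0) := by
    intro i a b
    by_cases hab : a = b
    · subst hab; simp
    · by_cases ha : i = a
      · subst ha
        simp [hab, Ne.symm hab]
      · by_cases hb : i = b
        · subst hb
          simp [hab, Ne.symm hab, dist_comm]
        · simp [ha, hb, Ne.symm ha, Ne.symm hb]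
  have h1 : ∀ a b, ∑ i, dist (Function.update y i c a) (Function.update y i c b) =
      (N - 2) * dist (y a) (y b) + (if a = b then 0 else dist c (y b)) +
        (if a = b then 0 else dist c (y a)) := fun a b => by
    simp only [key, Finset.sum_add_distrib, Finset.sum_ite_eq', Finset.mem_univ, if_true,
      Finset.sum_const, Finset.card_univ, nsmul_eq_mul, ← hN]
    ring
  have h2 : ∀ b, ∑ a, (if a = b then 0 else dist c (y b)) = (N - 1) * dist c (y b) := fun b => by
    have : ∀ a, (if a = b then 0 else dist c (y b)) =
        dist c (y b) - if a = b then dist c (y b) else 0 := fun a => by split_ifs <;> simp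
    simp only [this, Finset.sum_sub_distrib, Finset.sum_const, Finset.card_univ, nsmul_eq_mul,
      ← hN, Finset.sum_ite_eq', Finset.mem_univ, if_true]
    ring
  have h3 : ∀ a, ∑ b, (if a = b then 0 else dist c (y a)) = (N - 1) * dist c (y a) := fun a => by
    rw [← h2 a]
    exact Finset.sum_congr rfl fun b _ => by simp only [eq_comm]
  have hN1 : 0 ≤ N - 1 := by
    have : 0 < Fintype.card ι := by
      rw [hN] at hN0
      exact_mod_cast hN0
    have : (1 : ℝ) ≤ Fintype.card ι := by exact_mod_cast this
    linarith
  have h4 : ∑ b, dist c (y b) ≤ N⁻¹ * spread y := by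
    refine (Finset.sum_le_sum fun b _ => hg b).trans_eq ?_
    rw [← Finset.mul_sum, spread, Finset.sum_comm]
  calc ∑ i, spread (Function.update y i c)
      = ∑ a, ∑ b, ∑ i, dist (Function.update y i c a) (Function.update y i c b) := by
        unfold spread
        rw [Finset.sum_comm]
        exact Finset.sum_congr rfl fun a _ => Finset.sum_comm
    _ = (N - 2) * spread y + 2 * ((N - 1) * ∑ b, dist c (y b)) := by
        simp only [h1, Finset.sum_add_distrib, h3]
        rw [Finset.sum_comm (f := fun a b => if a = b then 0 else dist c (y b))]
        simp only [h2, ← Finset.mul_sum]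
        rw [spread]
        ring
    _ ≤ (N - 2) * spread y + 2 * ((N - 1) * (N⁻¹ * spread y)) := by gcongr
    _ = (N - 2 / N) * spread y := by field_simp; ring

end Spread

/-! ### Combinatorics of a stage of uniform subdivision -/

namespace NBCS

variable {d : ℕ}

/-- Splitting a list `L` of simplices at their barycenters replaces each of them by its children;
`ν σ` is the index of the barycenter of `σ`, and `R` lists the simplices that are not split. -/
theorem exists_foldl_splitBarycenter (L R : List (Fin (d + 1) → ℕ)) (B : NBCS d) (hL : L.Nodup)
    (hperm : B.cells.Perm (L ++ R)) (hv : ∀ σ ∈ L, ∀ i, σ i < B.size) :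
    ∃ ν : (Fin (d + 1) → ℕ) → ℕ,
      (∀ σ ∈ L, B.size ≤ ν σ ∧ (L.foldl splitBarycenter B).pt (ν σ) = B.barycenter σ) ∧
      (∀ σ ∈ L, ∀ τ ∈ L, ν σ = ν τ → σ = τ) ∧
      (∀ k < B.size, (L.foldl splitBarycenter B).pt k = B.pt k) ∧
      (L.foldl splitBarycenter B).cells.Perm
        (L.flatMap (fun σ => List.ofFn fun i => Function.update σ i (ν σ)) ++ R) := by
  induction L generalizing B R with
  | nil => exact ⟨fun _ => 0, by simp, by simp, by simp, by simpa using hperm⟩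
  | cons σ L ih =>
    rw [List.nodup_cons] at hL
    set B1 := B.splitBarycenter σ with hB1
    set C := List.ofFn (fun i => Function.update σ i B.size) with hC
    have hsize : B1.size = B.size + 1 := rfl
    have hpt : ∀ k < B.size, B1.pt k = B.pt k := fun k hk => by
      simp [hB1, splitBarycenter, split, hk.ne]
    have hpt' : B1.pt B.size = B.barycenter σ := by
      simp [hB1, splitBarycenter, split]
    have hperm1 : B1.cells.Perm (L ++ (R ++ C)) := by
      have h1 : B1.cells = B.cells.erase σ ++ C := rfl
      rw [h1, ← List.append_assoc]
      refine List.Perm.append_right _ ?_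
      simpa using hperm.erase σ
    obtain ⟨ν, h1, h2, h3, h4⟩ := ih (R ++ C) B1 hL.2 hperm1
      (fun τ hτ i => (hv τ (by simp [hτ]) i).trans (by omega))
    have hne : ∀ τ ∈ L, τ ≠ σ := fun τ hτ h => hL.1 (h ▸ hτ)
    have hbary : ∀ τ ∈ L, B1.barycenter τ = B.barycenter τ := fun τ hτ => by
      simp only [barycenter]
      congr 1
      exact Finset.sum_congr rfl fun i _ => hpt _ (hv τ (by simp [hτ]) i)
    refine ⟨Function.update ν σ B.size, ?_, ?_, ?_, ?_⟩
    · intro τ hτ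
      rcases List.mem_cons.1 hτ with rfl | hτ
      · rw [Function.update_self]
        exact ⟨le_rfl, by rw [List.foldl_cons, h3 _ (by omega), hpt']⟩
      · rw [Function.update_of_ne (hne τ hτ), ← hbary τ hτ]
        exact ⟨by have := (h1 τ hτ).1; omega, (h1 τ hτ).2⟩
    · intro τ hτ τ' hτ' h
      rcases List.mem_cons.1 hτ with e | m <;> rcases List.mem_cons.1 hτ' with e' | m'
      · rw [e, e']
      · rw [e, Function.update_self, Function.update_of_ne (hne τ' m')] at h
        have := (h1 τ' m').1
        omega
      · rw [e', Function.update_self, Function.update_of_ne (hne τ m)] at h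
        have := (h1 τ m).1
        omega
      · rw [Function.update_of_ne (hne τ m), Function.update_of_ne (hne τ' m')] at h
        exact h2 τ m τ' m' h
    · intro k hk
      rw [List.foldl_cons, h3 k (by omega), hpt k hk]
    · have h5 : (L.flatMap fun τ => List.ofFn fun i =>
          Function.update τ i (Function.update ν σ B.size τ)) =
          L.flatMap (fun τ => List.ofFn fun i => Function.update τ i (ν τ)) := by
        rw [List.flatMap_def, List.flatMap_def]
        congr 1
        exact List.map_congr_left fun τ hτ => by simp only [Function.update_of_ne (hne τ hτ)]
      rw [List.foldl_cons, List.flatMap_cons, h5, Function.update_self]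
      refine h4.trans ?_
      rw [List.append_assoc]
      refine (List.Perm.append_left _ List.perm_append_comm).trans ?_
      rw [← List.append_assoc, ← List.append_assoc]
      exact List.Perm.append_right _ List.perm_append_comm

theorem valid_uniformSubdivision (q : Fin (d + 1) → EuclideanSpace ℝ (Fin d)) (s : ℕ) :
    (uniformSubdivision q s).Valid := by
  induction s with
  | zero =>
    exact ⟨by simp [uniformSubdivision, init],
      by simpa [uniformSubdivision, init] using fun i : Fin (d + 1) => Nat.le_of_lt_succ i.isLt⟩
  | succ s ih =>
    exact (foldl_splitBarycenter _ ih.1 _ (fun _ h => h) ih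
      (isNested_uniformSubdivision q s)).1

/-- The vertices of the simplex `σ` of the system. -/
noncomputable def verts (B : NBCS d) (σ : Fin (d + 1) → ℕ) :
    Fin (d + 1) → EuclideanSpace ℝ (Fin d) :=
  fun i => B.pt (σ i)

/-- The simplex `σ` of the system as a set of points. -/
noncomputable def hull (B : NBCS d) (σ : Fin (d + 1) → ℕ) : Set (EuclideanSpace ℝ (Fin d)) :=
  convexHull ℝ (Set.range (B.verts σ))

theorem mem_hull_iff {B : NBCS d} {σ : Fin (d + 1) → ℕ} {x : EuclideanSpace ℝ (Fin d)} :
    x ∈ B.hull σ ↔ ∃ α : Fin (d + 1) → ℝ, (∀ i, 0 ≤ α i) ∧ ∑ i, α i = 1 ∧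
      ∑ i, α i • B.pt (σ i) = x :=
  mem_convexHull_range_iff

theorem barycenter_eq (B : NBCS d) (σ : Fin (d + 1) → ℕ) :
    B.barycenter σ = ∑ i, ((d : ℝ) + 1)⁻¹ • B.verts σ i := by
  rw [← Finset.smul_sum]; rfl

theorem barycenter_mem_hull (B : NBCS d) (σ : Fin (d + 1) → ℕ) : B.barycenter σ ∈ B.hull σ :=
  mem_convexHull_range_iff.2 ⟨fun _ => ((d : ℝ) + 1)⁻¹, fun _ => by positivity,
    by simp [mul_inv_cancel₀ (show (d : ℝ) + 1 ≠ 0 by positivity)], (barycenter_eq B σ).symm⟩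

/-- The effect of one stage of uniform subdivision; `ν σ` is the index of the barycenter of the
simplex `σ`. -/
theorem exists_uniformStage {B : NBCS d} (hB : B.Valid) :
    ∃ ν : (Fin (d + 1) → ℕ) → ℕ,
      (∀ σ ∈ B.cells, B.size ≤ ν σ) ∧
      (∀ σ ∈ B.cells, ∀ τ ∈ B.cells, ν σ = ν τ → σ = τ) ∧
      (∀ σ ∈ B.cells, ∀ i, B.uniformStage.verts (Function.update σ i (ν σ)) =
        Function.update (B.verts σ) i (B.barycenter σ)) ∧
      B.uniformStage.cells.Perm
        (B.cells.flatMap fun σ => List.ofFn fun i => Function.update σ i (ν σ)) := by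
  obtain ⟨ν, h1, h2, h3, h4⟩ := exists_foldl_splitBarycenter B.cells [] B hB.1 (by simp) hB.2
  refine ⟨ν, fun σ hσ => (h1 σ hσ).1, h2, fun σ hσ i => ?_, by rwa [List.append_nil] at h4⟩
  funext j
  rcases eq_or_ne j i with rfl | h
  · simpa [verts] using! (h1 σ hσ).2
  · simpa [verts, h] using! h3 _ (hB.2 σ hσ j)

/-- Sums over the simplices of the next stage are sums over the children of the current ones. -/
theorem sum_cells_uniformStage {B : NBCS d} (hB : B.Valid)
    (Φ : (Fin (d + 1) → EuclideanSpace ℝ (Fin d)) → ℝ) :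
    (B.uniformStage.cells.map fun τ => Φ (B.uniformStage.verts τ)).sum =
      (B.cells.map fun σ =>
        ∑ i, Φ (Function.update (B.verts σ) i (B.barycenter σ))).sum := by
  obtain ⟨ν, -, -, h3, h4⟩ := exists_uniformStage hB
  rw [(h4.map _).sum_eq, List.map_flatMap, List.flatMap_def, List.sum_flatten,
    List.map_map]
  congr 1
  refine List.map_congr_left fun σ hσ => ?_
  rw [Function.comp_apply, List.map_ofFn, List.sum_ofFn]
  exact Finset.sum_congr rfl fun i _ => by rw [Function.comp_apply, h3 σ hσ i]

/-- Each simplex of the next stage has a vertex that determines the simplex it was split from. -/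
theorem exists_parent {B : NBCS d} (hB : B.Valid) {τ : Fin (d + 1) → ℕ}
    (hτ : τ ∈ B.uniformStage.cells) :
    ∃ σ ∈ B.cells, ∃ i, ∀ τ' ∈ B.uniformStage.cells, ∀ j, τ' j = τ i →
      B.uniformStage.hull τ' ⊆ B.hull σ := by
  obtain ⟨ν, h1, h2, h3, h4⟩ := exists_uniformStage hB
  have hmem : ∀ τ ∈ B.uniformStage.cells, ∃ σ ∈ B.cells, ∃ i, Function.update σ i (ν σ) = τ := by
    intro τ hτ
    obtain ⟨σ, hσ, h⟩ := List.mem_flatMap.1 (h4.mem_iff.1 hτ)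
    obtain ⟨i, hi⟩ := (List.mem_ofFn' _ _).1 h
    exact ⟨σ, hσ, i, hi⟩
  obtain ⟨σ, hσ, i, rfl⟩ := hmem τ hτ
  refine ⟨σ, hσ, i, fun τ' hτ' j hj => ?_⟩
  obtain ⟨σ', hσ', i', rfl⟩ := hmem τ' hτ'
  rw [Function.update_self] at hj
  -- the index `ν σ` is new, so it can only be the new vertex of a child
  have hj' : j = i' := by
    by_contra hne
    rw [Function.update_of_ne hne] at hj
    have := h1 σ hσ
    have := hB.2 σ' hσ' j
    omega
  subst hj'
  rw [Function.update_self] at hj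
  obtain rfl := h2 σ' hσ' σ hσ hj
  rw [hull, h3 σ' hσ']
  exact convexHull_range_update_subset (barycenter_mem_hull B σ') j

/-- The children of a simplex cover it. -/
theorem exists_mem_hull_uniformStage {B : NBCS d} (hB : B.Valid) {σ : Fin (d + 1) → ℕ}
    (hσ : σ ∈ B.cells) {x : EuclideanSpace ℝ (Fin d)} (hx : x ∈ B.hull σ) :
    ∃ τ ∈ B.uniformStage.cells, x ∈ B.uniformStage.hull τ := by
  obtain ⟨ν, -, -, h3, h4⟩ := exists_uniformStage hB
  obtain ⟨α, h0, h1, rfl⟩ := mem_hull_iff.1 hx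
  obtain ⟨i, -, hi⟩ := Finset.exists_min_image Finset.univ α Finset.univ_nonempty
  refine ⟨Function.update σ i (ν σ), h4.mem_iff.2 (List.mem_flatMap.2
    ⟨σ, hσ, (List.mem_ofFn' _ _).2 ⟨i, rfl⟩⟩), ?_⟩
  rw [hull, h3 σ hσ]
  -- the child opposite to a vertex with minimal coefficient contains the point
  refine mem_convexHull_range_iff.2
    ⟨fun j => α j - α i + if j = i then ((d : ℝ) + 1) * α i else 0, fun j => ?_, ?_, ?_⟩
  · have := hi j (Finset.mem_univ j)
    have := h0 i
    dsimp only
    split_ifs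
    · have : 0 ≤ ((d : ℝ) + 1) * α i := by positivity
      linarith
    · linarith
  · simp [Finset.sum_add_distrib, Finset.sum_sub_distrib, h1]
  · have h5 : ∀ j, (α j - α i + if j = i then ((d : ℝ) + 1) * α i else 0) •
        Function.update (B.verts σ) i (B.barycenter σ) j =
        (α j - α i) • B.verts σ j +
          if j = i then (((d : ℝ) + 1) * α i) • B.barycenter σ else 0 := by
      intro j
      rcases eq_or_ne j i with rfl | h
      · simp
      · simp [h]
    simp only [h5, Finset.sum_add_distrib, Finset.sum_ite_eq', Finset.mem_univ, if_true, sub_smul,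
      Finset.sum_sub_distrib, ← Finset.smul_sum]
    rw [barycenter_eq, ← Finset.smul_sum, smul_smul, mul_right_comm,
      mul_inv_cancel₀ (show (d : ℝ) + 1 ≠ 0 by positivity), one_mul]
    simp [verts]

theorem verts_uniformSubdivision_zero (q : Fin (d + 1) → EuclideanSpace ℝ (Fin d)) :
    (uniformSubdivision q 0).verts (fun i => (i : ℕ)) = q := by
  funext i
  exact dif_pos i.isLt

theorem exists_mem_hull_uniformSubdivision (q : Fin (d + 1) → EuclideanSpace ℝ (Fin d)) (s : ℕ)
    {x : EuclideanSpace ℝ (Fin d)} (hx : x ∈ convexHull ℝ (Set.range q)) :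
    ∃ σ ∈ (uniformSubdivision q s).cells, x ∈ (uniformSubdivision q s).hull σ := by
  induction s with
  | zero =>
    refine ⟨fun i => (i : ℕ), by simp [uniformSubdivision, init], ?_⟩
    rwa [hull, verts_uniformSubdivision_zero]
  | succ s ih =>
    obtain ⟨σ, hσ, h⟩ := ih
    exact exists_mem_hull_uniformStage (valid_uniformSubdivision q s) hσ h

/-- Pairing weights with a vector of coefficients gives the weighted mean over the vertices of the
simplex. -/
theorem dotProduct_of_coeff {B : NBCS d} {σ : Fin (d + 1) → ℕ} (hσ : ∀ i, σ i < B.size)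
    {α : Fin (d + 1) → ℝ} {v : Fin B.size → ℝ}
    (hv : ∀ k : Fin B.size, v k = ∑ i, if σ i = (k : ℕ) then α i else 0) (w : Fin B.size → ℝ) :
    w ⬝ᵥ v = ∑ i, α i * w ⟨σ i, hσ i⟩ := by
  simp only [dotProduct, hv, Finset.mul_sum]
  rw [Finset.sum_comm]
  refine Finset.sum_congr rfl fun i _ => ?_
  rw [Finset.sum_eq_single ⟨σ i, hσ i⟩]
  · simp [mul_comm]
  · intro k _ hk
    rw [if_neg (fun h => hk (Fin.ext h.symm)), mul_zero]
  · simp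

/-- The value at `x` of the function with weights `w`, through some simplex containing `x`. -/
theorem exists_dotProduct_embed {B : NBCS d} (hB : B.Valid) {x : EuclideanSpace ℝ (Fin d)}
    (hx : ∃ σ ∈ B.cells, x ∈ B.hull σ) (w : Fin B.size → ℝ) :
    ∃ σ, ∃ hσ : σ ∈ B.cells, ∃ α : Fin (d + 1) → ℝ, (∀ i, 0 ≤ α i) ∧ ∑ i, α i = 1 ∧
      ∑ i, α i • B.pt (σ i) = x ∧ w ⬝ᵥ B.embed x = ∑ i, α i * w ⟨σ i, hB.2 σ hσ i⟩ := by
  have h : ∃ v, B.IsEmbedding x v := by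
    obtain ⟨σ, hσ, hx⟩ := hx
    obtain ⟨α, h0, h1, h2⟩ := mem_hull_iff.1 hx
    exact ⟨_, σ, hσ, α, h0, h1, h2, fun k => rfl⟩
  have he : B.IsEmbedding x (B.embed x) := by
    rw [embed, dif_pos h]
    exact h.choose_spec
  obtain ⟨σ, hσ, α, h0, h1, h2, h3⟩ := he
  exact ⟨σ, hσ, α, h0, h1, h2, dotProduct_of_coeff (hB.2 σ hσ) h3 w⟩

end NBCS

/-! ### Decay of the spread under uniform subdivision -/

theorem AffineMap.map_sum_smul {ι E F : Type*} [Fintype ι] [AddCommGroup E] [Module ℝ E]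
    [AddCommGroup F] [Module ℝ F] (A : E →ᵃ[ℝ] F) (v : ι → E) {β : ι → ℝ} (hβ : ∑ i, β i = 1) :
    A (∑ i, β i • v i) = ∑ i, β i • A (v i) := by
  rw [← Finset.univ.affineCombination_eq_linear_combination _ _ hβ,
    Finset.univ.map_affineCombination _ _ hβ,
    Finset.univ.affineCombination_eq_linear_combination _ _ hβ]
  rfl

namespace NBCS

variable {d : ℕ}

theorem isCompact_hull (B : NBCS d) (σ : Fin (d + 1) → ℕ) : IsCompact (B.hull σ) :=
  (Set.finite_range _).isCompact_convexHull ℝ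

/-- The expected spread of a random simplex of the `s`-stage uniform subdivision, where simplices
are weighted by volume, decays exponentially in `s`. -/
theorem sum_measure_mul_spread_le {q : Fin (d + 1) → EuclideanSpace ℝ (Fin d)}
    (b : AffineBasis (Fin (d + 1)) ℝ (EuclideanSpace ℝ (Fin d))) (hb : ⇑b = q) (hd : d ≠ 0)
    (s : ℕ) :
    ((uniformSubdivision q s).cells.map fun σ => volume.real ((uniformSubdivision q s).hull σ) *
      spread fun i => b.coords ((uniformSubdivision q s).verts σ i)).sum ≤
      (1 - 2 / ((d : ℝ) + 1) ^ 2) ^ s *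
        (volume.real (convexHull ℝ (Set.range q)) * ((d : ℝ) + 1) ^ 2) := by
  have hd1 : (1 : ℝ) ≤ d := by exact_mod_cast Nat.one_le_iff_ne_zero.2 hd
  have hN : (0 : ℝ) < (d : ℝ) + 1 := by positivity
  induction s with
  | zero =>
    have h1 : (uniformSubdivision q 0).cells = [fun i : Fin (d + 1) => (i : ℕ)] := rfl
    simp only [h1, List.map_cons, List.map_nil, List.sum_cons, List.sum_nil, add_zero, pow_zero,
      one_mul, hull, verts_uniformSubdivision_zero]
    gcongr
    have h2 : ∀ i j : Fin (d + 1), dist (b.coords (q i)) (b.coords (q j)) ≤ 1 := fun i j => by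
      refine (dist_pi_le_iff zero_le_one).2 fun k => ?_
      rw [b.coords_apply, b.coords_apply, ← hb, b.coord_apply, b.coord_apply, Real.dist_eq]
      split_ifs <;> simp
    calc _ ≤ ∑ i : Fin (d + 1), ∑ j : Fin (d + 1), (1 : ℝ) :=
          Finset.sum_le_sum fun i _ => Finset.sum_le_sum fun j _ => h2 i j
      _ = _ := by simp; ring
  | succ s ih =>
    set B := uniformSubdivision q s
    have hs := sum_cells_uniformStage (valid_uniformSubdivision q s)
      (fun v => volume.real (convexHull ℝ (Set.range v)) * spread fun i => b.coords (v i))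
    refine hs.trans_le ?_
    have hstep : ∀ σ ∈ B.cells, ∑ i, volume.real (convexHull ℝ (Set.range
        (Function.update (B.verts σ) i (B.barycenter σ)))) *
          (spread fun j => b.coords (Function.update (B.verts σ) i (B.barycenter σ) j)) ≤
        (1 - 2 / ((d : ℝ) + 1) ^ 2) *
          (volume.real (B.hull σ) * spread fun i => b.coords (B.verts σ i)) := by
      intro σ _
      have hsum : ∑ _j : Fin (d + 1), ((d : ℝ) + 1)⁻¹ = 1 := by
        simp [mul_inv_cancel₀ hN.ne']
      have hvol : ∀ i, volume.real (convexHull ℝ (Set.range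
          (Function.update (B.verts σ) i (B.barycenter σ)))) =
          ((d : ℝ) + 1)⁻¹ * volume.real (B.hull σ) := fun i => by
        rw [barycenter_eq, measureReal_def, measure_convexHull_update volume (by simp) (B.verts σ) i
          (fun _ => by positivity) hsum, ENNReal.toReal_mul,
          ENNReal.toReal_ofReal (by positivity)]
        rfl
      have hupd : ∀ i, (fun j => b.coords (Function.update (B.verts σ) i (B.barycenter σ) j)) =
          Function.update (fun j => b.coords (B.verts σ j)) i
            (((d : ℝ) + 1)⁻¹ • ∑ j, b.coords (B.verts σ j)) := fun i => by
        have : b.coords (B.barycenter σ) = ((d : ℝ) + 1)⁻¹ • ∑ j, b.coords (B.verts σ j) := by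
          rw [barycenter_eq, b.coords.map_sum_smul _ hsum, Finset.smul_sum]
        rw [← this]
        funext j
        rcases eq_or_ne j i with rfl | h <;> simp [*]
      simp only [hvol, hupd, ← Finset.mul_sum]
      refine (mul_le_mul_of_nonneg_left (sum_spread_update_le _ (N := (d : ℝ) + 1) (by simp) hN)
        (by positivity)).trans_eq ?_
      field_simp
    refine (List.sum_le_sum hstep).trans ?_
    rw [List.sum_map_mul_left, pow_succ' _ s, mul_assoc]
    refine mul_le_mul_of_nonneg_left ih ?_
    rw [sub_nonneg, div_le_one (by positivity)]
    nlinarith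

/-- The simplices of large spread have small total volume. -/
theorem measure_long_le {q : Fin (d + 1) → EuclideanSpace ℝ (Fin d)}
    (b : AffineBasis (Fin (d + 1)) ℝ (EuclideanSpace ℝ (Fin d))) (hb : ⇑b = q) (hd : d ≠ 0)
    (s : ℕ) {n : ℕ} (hn : n ≠ 0) :
    volume.real (⋃ σ ∈ (uniformSubdivision q s).cells.toFinset.filter (fun σ => (n : ℝ)⁻¹ <
      spread fun i => b.coords ((uniformSubdivision q s).verts σ i)),
        (uniformSubdivision q s).hull σ) ≤
      n * ((1 - 2 / ((d : ℝ) + 1) ^ 2) ^ s *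
        (volume.real (convexHull ℝ (Set.range q)) * ((d : ℝ) + 1) ^ 2)) := by
  have hn0 : (0 : ℝ) < n := by positivity
  set B := uniformSubdivision q s with hB
  have hnodup := (valid_uniformSubdivision q s).1
  calc _ ≤ ∑ σ ∈ B.cells.toFinset.filter (fun σ => (n : ℝ)⁻¹ < spread fun i =>
          b.coords (B.verts σ i)), volume.real (B.hull σ) := measureReal_biUnion_finset_le _ _
    _ ≤ ∑ σ ∈ B.cells.toFinset.filter (fun σ => (n : ℝ)⁻¹ < spread fun i =>
          b.coords (B.verts σ i)),
          n * (volume.real (B.hull σ) * spread fun i => b.coords (B.verts σ i)) := by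
        refine Finset.sum_le_sum fun σ hσ => ?_
        have h1 : 1 ≤ (spread fun i => b.coords (B.verts σ i)) * n :=
          ((inv_lt_iff_one_lt_mul₀ hn0).1 (Finset.mem_filter.1 hσ).2).le
        calc volume.real (B.hull σ) = volume.real (B.hull σ) * 1 := (mul_one _).symm
          _ ≤ volume.real (B.hull σ) * ((spread fun i => b.coords (B.verts σ i)) * n) := by gcongr
          _ = _ := by ring
    _ ≤ ∑ σ ∈ B.cells.toFinset,
          n * (volume.real (B.hull σ) * spread fun i => b.coords (B.verts σ i)) :=
        Finset.sum_le_sum_of_subset_of_nonneg (Finset.filter_subset _ _) fun σ _ _ =>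
          mul_nonneg hn0.le (mul_nonneg measureReal_nonneg (spread_nonneg _))
    _ = n * (B.cells.map fun σ => volume.real (B.hull σ) *
          spread fun i => b.coords (B.verts σ i)).sum := by
        rw [← Finset.mul_sum, List.sum_toFinset _ hnodup]
    _ ≤ _ := by
        gcongr
        exact sum_measure_mul_spread_le b hb hd s

/-! ### The region of the weights -/

open Classical in
/-- The weights that are `-1` at the coordinate points all of whose simplices miss `P`, and `0` at
the other ones. -/
noncomputable def missWeight (B : NBCS d) (P : Set (EuclideanSpace ℝ (Fin d)))
    (k : Fin B.size) : ℝ :=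
  if ∀ τ ∈ B.cells, (∃ i, τ i = (k : ℕ)) → Disjoint (B.hull τ) P then -1 else 0

/-- A simplex containing a point of `P` has no vertex of negative weight. -/
theorem subset_region_missWeight {B : NBCS d} (hB : B.Valid) {S P : Set (EuclideanSpace ℝ (Fin d))}
    (hPS : P ⊆ S) (hS : ∀ x ∈ S, ∃ σ ∈ B.cells, x ∈ B.hull σ) :
    P ⊆ B.region S (B.missWeight P) := by
  intro x hx
  refine ⟨hPS hx, ?_⟩
  obtain ⟨σ, hσ, α, h0, h1, h2, h3⟩ := exists_dotProduct_embed hB (hS x (hPS hx)) (B.missWeight P)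
  rw [h3]
  refine Finset.sum_nonneg fun i _ => ?_
  rw [missWeight, if_neg, mul_zero]
  intro h
  exact Set.disjoint_left.1 (h σ hσ ⟨i, rfl⟩) (mem_hull_iff.2 ⟨α, h0, h1, h2⟩) hx

/-- With the weights `missWeight`, the points of the region outside of `P` lie on a facet of a
simplex, or near `P`, or in a simplex of large spread. -/
theorem measure_region_missWeight_diff_le {q : Fin (d + 1) → EuclideanSpace ℝ (Fin d)}
    (b : AffineBasis (Fin (d + 1)) ℝ (EuclideanSpace ℝ (Fin d))) (hb : ⇑b = q) (hd : d ≠ 0)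
    {P : Set (EuclideanSpace ℝ (Fin d))} (hP : IsCompact P) (hPc : Convex ℝ P)
    (hPS : P ⊆ convexHull ℝ (Set.range q)) (s : ℕ) {n : ℕ} (hn : n ≠ 0) :
    volume.real ((uniformSubdivision q (s + 1)).region (convexHull ℝ (Set.range q))
        ((uniformSubdivision q (s + 1)).missWeight P) \ P) ≤
      ((2 * (d + 1) * (2 * (d + 1) ^ 2 + 1) ^ d : ℕ) / n +
        n * ((1 - 2 / ((d : ℝ) + 1) ^ 2) ^ s * ((d : ℝ) + 1) ^ 2)) *
        volume.real (convexHull ℝ (Set.range q)) := by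
  have hn0 : (0 : ℝ) < n := by positivity
  have : Nontrivial (Fin (d + 1)) := Fin.nontrivial_iff_two_le.2 (by omega)
  set S := convexHull ℝ (Set.range q) with hS
  have hSc : IsCompact S := (Set.finite_range _).isCompact_convexHull ℝ
  set B := uniformSubdivision q s with hB
  have hBv : B.Valid := valid_uniformSubdivision q s
  have hBv' : B.uniformStage.Valid := valid_uniformSubdivision q (s + 1)
  have hcov : ∀ x ∈ S, ∃ σ ∈ B.uniformStage.cells, x ∈ B.uniformStage.hull σ := fun x hx =>
    exists_mem_hull_uniformSubdivision q (s + 1) hx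
  change volume.real (B.uniformStage.region S (B.uniformStage.missWeight P) \ P) ≤ _
  set Facets := ⋃ τ ∈ B.uniformStage.cells.toFinset, ⋃ i, {x | ∃ α : Fin (d + 1) → ℝ,
    (∀ j, 0 ≤ α j) ∧ ∑ j, α j = 1 ∧ ∑ j, α j • B.uniformStage.verts τ j = x ∧ α i = 0} with hF
  set Shell := sweep (n : ℝ)⁻¹ P (edgeDirs b) \ P with hShell
  set Long := ⋃ σ ∈ B.cells.toFinset.filter (fun σ => (n : ℝ)⁻¹ <
      spread fun i => b.coords (B.verts σ i)), B.hull σ with hLong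
  have hsub : B.uniformStage.region S (B.uniformStage.missWeight P) \ P ⊆
      (Shell ∪ Long) ∪ Facets := by
    rintro x ⟨⟨hxS, hxw⟩, hxP⟩
    obtain ⟨τ, hτ, α, h0, h1, h2, h3⟩ :=
      exists_dotProduct_embed hBv' (hcov x hxS) (B.uniformStage.missWeight P)
    by_cases hα : ∃ i, α i = 0
    · obtain ⟨i, hi⟩ := hα
      refine Or.inr ?_
      simp only [hF, Set.mem_iUnion]
      exact ⟨τ, by simpa using hτ, i, α, h0, h1, h2, hi⟩
    refine Or.inl ?_
    push Not at hα
    have hxτ : x ∈ B.uniformStage.hull τ := mem_hull_iff.2 ⟨α, h0, h1, h2⟩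
    obtain ⟨σ, hσ, i, hpar⟩ := exists_parent hBv hτ
    -- all weights at the vertices of `τ` vanish, in particular the one at the new vertex
    have hnp : ∀ k, B.uniformStage.missWeight P k ≤ 0 := fun k => by
      rw [missWeight]; split_ifs <;> norm_num
    have hi : B.uniformStage.missWeight P ⟨τ i, hBv'.2 τ hτ i⟩ = 0 := by
      rw [h3] at hxw
      by_contra hne
      have hlt := lt_of_le_of_ne (hnp _) hne
      have : ∑ j, α j * B.uniformStage.missWeight P ⟨τ j, hBv'.2 τ hτ j⟩ < 0 :=
        Finset.sum_neg' (fun j _ => mul_nonpos_of_nonneg_of_nonpos (h0 j) (hnp _))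
          ⟨i, Finset.mem_univ i, mul_neg_of_pos_of_neg ((h0 i).lt_of_ne (hα i).symm) hlt⟩
      linarith
    have hex : ∃ τ' ∈ B.uniformStage.cells, (∃ j, τ' j = τ i) ∧
        ¬ Disjoint (B.uniformStage.hull τ') P := by
      by_contra hcon
      push Not at hcon
      rw [missWeight, if_pos hcon] at hi
      norm_num at hi
    obtain ⟨τ', hτ', ⟨j, hj⟩, hmeet⟩ := hex
    obtain ⟨p, hpτ, hpP⟩ := Set.not_disjoint_iff.1 hmeet
    have hxσ := hpar τ hτ i rfl hxτ
    have hpσ := hpar τ' hτ' j hj hpτ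
    by_cases hsp : (n : ℝ)⁻¹ < spread fun i => b.coords (B.verts σ i)
    · refine Or.inr ?_
      simp only [hLong, Set.mem_iUnion]
      exact ⟨σ, by simpa using ⟨hσ, hsp⟩, hxσ⟩
    · refine Or.inl ⟨mem_sweep_edgeDirs b hpP ?_, hxP⟩
      have himg : ∀ y ∈ B.hull σ, b.coords y ∈
          convexHull ℝ (Set.range fun i => b.coords (B.verts σ i)) := fun y hy => by
        have := Set.mem_image_of_mem b.coords hy
        rwa [hull, AffineMap.image_convexHull, ← Set.range_comp] at this
      exact (dist_le_spread (himg x hxσ) (himg p hpσ)).trans (not_lt.1 hsp)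
  have hFz : volume Facets = 0 :=
    (measure_biUnion_null_iff (Finset.countable_toSet B.uniformStage.cells.toFinset)).2
      fun τ _ => measure_iUnion_null fun i => measure_facet_eq_zero volume (by simp) _ i
  have hF0 : volume.real Facets = 0 := by rw [measureReal_def, hFz, ENNReal.toReal_zero]
  have hFfin : volume Facets ≠ ⊤ := by simp [hFz]
  have hLfin : volume Long ≠ ⊤ :=
    (measure_biUnion_lt_top (Finset.finite_toSet _) fun σ _ =>
      (B.isCompact_hull σ).measure_lt_top).ne
  have hShfin : volume Shell ≠ ⊤ :=
    (measure_mono Set.sdiff_subset |>.trans_lt (hP.sweep _ _).measure_lt_top).ne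
  have hSh : volume.real Shell ≤
      (2 * (d + 1) * (2 * (d + 1) ^ 2 + 1) ^ d : ℕ) / n * volume.real S := by
    have h := measure_shell_le (m := d) volume (by simp) b hP hPc (by rwa [hb]) hn
    have h' := ENNReal.toReal_mono (ENNReal.mul_ne_top (ENNReal.natCast_ne_top _)
      (by rw [hb]; exact hSc.measure_lt_top.ne)) h
    rw [ENNReal.toReal_mul, ENNReal.toReal_mul, ENNReal.toReal_natCast, ENNReal.toReal_natCast,
      hb] at h'
    rw [div_mul_eq_mul_div, le_div_iff₀ hn0, mul_comm]
    exact h'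
  calc _ ≤ volume.real ((Shell ∪ Long) ∪ Facets) := measureReal_mono hsub
        (measure_union_lt_top (measure_union_lt_top hShfin.lt_top hLfin.lt_top)
          hFfin.lt_top).ne
    _ ≤ volume.real Shell + volume.real Long + volume.real Facets :=
        (measureReal_union_le _ _).trans (by gcongr; exact measureReal_union_le _ _)
    _ ≤ _ := by
        have := measure_long_le b hb hd s hn
        rw [hF0, add_zero, add_mul]
        refine add_le_add hSh (this.trans_eq ?_)
        ring

end NBCS

/-! ### Inner parallel bodies -/

/-- If a region exceeds a closed convex set `P` by less than the volume of a half ball, then it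
contains no ball centered outside of `P`: a half ball of it would avoid `P`. -/
theorem innerParallel_subset_of_measure_lt {d : ℕ} {P R S : Set (EuclideanSpace ℝ (Fin d))}
    (hP : IsClosed P) (hPc : Convex ℝ P) {ε : ℝ} (hε : 0 < ε) {z : EuclideanSpace ℝ (Fin d)}
    (hS : S ⊆ Metric.closedBall z 1)
    (h : volume (R \ P) < ENNReal.ofReal (ε ^ d / 2) * volume S) :
    innerParallel R ε ⊆ P := by
  rintro p ⟨-, hball⟩
  by_contra hp
  obtain ⟨f, u, hfp, hfP⟩ := geometric_hahn_banach_point_closed hPc hP hp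
  set H := Metric.closedBall p ε ∩ {y | f y ≤ f p} with hH
  have hHm : MeasurableSet H :=
    (Metric.isClosed_closedBall.inter (isClosed_le f.continuous continuous_const)).measurableSet
  have hHsub : H ⊆ R \ P := fun y hy =>
    ⟨hball hy.1, fun hyP => by
      have h1 := hfP y hyP
      have h2 : f y ≤ f p := hy.2
      linarith⟩
  have hrefl : volume ((fun y => (p + p) - y) ⁻¹' H) = volume H :=
    (Measure.measurePreserving_sub_left volume (p + p)).measure_preimage hHm.nullMeasurableSet
  have hcov : Metric.closedBall p ε ⊆ H ∪ (fun y => (p + p) - y) ⁻¹' H := by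
    intro y hy
    rcases le_total (f y) (f p) with h1 | h1
    · exact Or.inl ⟨hy, h1⟩
    · refine Or.inr ⟨?_, ?_⟩
      · rw [Metric.mem_closedBall, dist_eq_norm] at hy ⊢
        rwa [show p + p - y - p = -(y - p) by abel, norm_neg]
      · change f (p + p - y) ≤ f p
        rw [map_sub, map_add]
        linarith
  have hvS : volume S ≤ volume (Metric.ball (0 : EuclideanSpace ℝ (Fin d)) 1) := by
    refine (measure_mono hS).trans_eq ?_
    rw [Measure.addHaar_closedBall _ _ zero_le_one]
    simp
  have h1 : volume (Metric.closedBall p ε) ≤ 2 * volume H := by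
    refine (measure_mono hcov).trans ((measure_union_le _ _).trans_eq ?_)
    rw [hrefl, two_mul]
  rw [Measure.addHaar_closedBall _ _ hε.le, finrank_euclideanSpace_fin] at h1
  have h2 : ENNReal.ofReal (ε ^ d) = 2 * ENNReal.ofReal (ε ^ d / 2) := by
    rw [← ENNReal.ofReal_ofNat 2, ← ENNReal.ofReal_mul (by norm_num)]
    congr 1
    ring
  rw [h2, mul_assoc] at h1
  have h3 := (ENNReal.mul_le_mul_iff_right two_ne_zero ENNReal.ofNat_ne_top).1 h1
  refine absurd (h.trans_le ((mul_le_mul_right hvS _).trans (h3.trans (measure_mono hHsub)))) ?_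
  exact lt_irrefl _


theorem innerParallel_eq_empty_of_diam_lt {d : ℕ} (hd : d ≠ 0)
    {R S : Set (EuclideanSpace ℝ (Fin d))} (hRS : R ⊆ S) (hS : Bornology.IsBounded S) {ε : ℝ}
    (hε0 : 0 ≤ ε) (hε : Metric.diam S < 2 * ε) : innerParallel R ε = ∅ := by
  refine Set.eq_empty_of_forall_notMem ?_
  rintro p ⟨-, hp⟩
  have : Nonempty (Fin d) := ⟨⟨0, by omega⟩⟩
  obtain ⟨e, he⟩ := exists_norm_eq (EuclideanSpace ℝ (Fin d)) hε0
  have h1 : p + e ∈ S := hRS (hp (by simp [he]))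
  have h2 : p - e ∈ S := hRS (hp (by simp [he]))
  have h3 := Metric.dist_le_diam_of_mem hS h1 h2
  rw [dist_eq_norm, add_sub_sub_cancel, ← two_smul ℝ, norm_smul, he] at h3
  norm_num at h3
  linarith

/-! ### Regions without subdivision -/

/-- A halfspace containing a point with large barycentric coefficients contains a substantial part
of the simplex: pull the vertices outside of the halfspace towards the deepest vertex, until they
lie on its boundary. -/
theorem exp_mul_measure_le_measure_halfspace {d : ℕ} (q : Fin (d + 1) → EuclideanSpace ℝ (Fin d))
    (g : EuclideanSpace ℝ (Fin d) →ᵃ[ℝ] ℝ) {l : Fin (d + 1) → ℝ} (hl1 : ∑ i, l i = 1)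
    (hl : ∀ i, (2 * ((d : ℝ) + 1))⁻¹ ≤ l i) (hg : ∑ i, l i * g (q i) < 0) :
    Real.exp (-(2 * ((d : ℝ) + 1))) * volume.real (convexHull ℝ (Set.range q)) ≤
      volume.real (convexHull ℝ (Set.range q) ∩ {x | g x ≤ 0}) := by
  obtain ⟨m, -, hm⟩ := Finset.exists_min_image Finset.univ (fun i => g (q i))
    Finset.univ_nonempty
  have hlpos : ∀ i, 0 < l i := fun i => lt_of_lt_of_le (by positivity) (hl i)
  set W := -g (q m) with hW
  have hge : ∀ i, -W ≤ g (q i) := fun i => by simpa [hW] using hm i (Finset.mem_univ i)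
  have hW0 : 0 < W := by
    by_contra hcon
    refine hg.not_ge (Finset.sum_nonneg fun i _ => mul_nonneg (hlpos i).le ?_)
    linarith [hge i]
  set a : Fin (d + 1) → ℝ := fun i => max (g (q i)) 0 with ha
  have ha0 : ∀ i, 0 ≤ a i := fun i => le_max_right _ _
  have hsum : ∑ i, a i ≤ 2 * ((d : ℝ) + 1) * W := by
    have h1 : ∑ i, l i * a i ≤ W := by
      calc ∑ i, l i * a i ≤ ∑ i, (l i * g (q i) + l i * W) := by
            refine Finset.sum_le_sum fun i _ => ?_
            rw [← mul_add]
            refine mul_le_mul_of_nonneg_left (max_le ?_ ?_) (hlpos i).le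
            · linarith
            · linarith [hge i]
        _ = ∑ i, l i * g (q i) + W := by
            rw [Finset.sum_add_distrib, ← Finset.sum_mul, hl1, one_mul]
        _ ≤ W := by linarith
    have h2 : (2 * ((d : ℝ) + 1))⁻¹ * ∑ i, a i ≤ W := by
      rw [Finset.mul_sum]
      exact (Finset.sum_le_sum fun i _ => mul_le_mul_of_nonneg_right (hl i) (ha0 i)).trans h1
    rwa [inv_mul_le_iff₀ (by positivity)] at h2
  set θ : Fin (d + 1) → ℝ := fun i => W / (W + a i) with hθ
  have hWa : ∀ i, 0 < W + a i := fun i => add_pos_of_pos_of_nonneg hW0 (ha0 i)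
  have hθ0 : ∀ i, 0 ≤ θ i := fun i => div_nonneg hW0.le (hWa i).le
  have hθ1 : ∀ i, θ i ≤ 1 := fun i => (div_le_one (hWa i)).2 (by linarith [ha0 i])
  have hvol := measure_convexHull_move volume (by simp) q m hθ0 hθ1 (Finset.univ.erase m)
    (Finset.notMem_erase _ _)
  set y : Fin (d + 1) → EuclideanSpace ℝ (Fin d) := fun j =>
    if j ∈ Finset.univ.erase m then θ j • q j + (1 - θ j) • q m else q j with hy
  have hsub : convexHull ℝ (Set.range y) ⊆ convexHull ℝ (Set.range q) ∩ {x | g x ≤ 0} := by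
    refine convexHull_min ?_ ((convex_convexHull ℝ _).inter
      ((convex_Iic (0 : ℝ)).affine_preimage g))
    rintro _ ⟨j, rfl⟩
    simp only [hy]
    split_ifs with hj
    · refine ⟨(convex_convexHull ℝ _) (subset_convexHull ℝ _ (Set.mem_range_self j))
        (subset_convexHull ℝ _ (Set.mem_range_self m)) (hθ0 j) (by linarith [hθ1 j]) (by ring), ?_⟩
      have h1 : g (θ j • q j + (1 - θ j) • q m) = θ j * g (q j) + (1 - θ j) * g (q m) := by
        have := Convex.combo_affine_apply (f := g) (x := q j) (y := q m)
          (show θ j + (1 - θ j) = 1 by ring)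
        simpa using this
      have h2 : θ j * (W + a j) = W := div_mul_cancel₀ _ (hWa j).ne'
      have h3 : θ j * g (q j) ≤ θ j * a j := mul_le_mul_of_nonneg_left (le_max_left _ _) (hθ0 j)
      change g _ ≤ 0
      rw [h1]
      have h4 : g (q m) = -W := by rw [hW, neg_neg]
      rw [h4]
      linarith
    · have : j = m := by simpa using hj
      subst this
      refine ⟨subset_convexHull ℝ _ (Set.mem_range_self j), ?_⟩
      change g (q j) ≤ 0
      linarith
  have hprod : Real.exp (-(2 * ((d : ℝ) + 1))) ≤ ∏ j ∈ Finset.univ.erase m, θ j := by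
    have h1 : ∀ j, Real.exp (-(a j / W)) ≤ θ j := fun j => by
      rw [Real.exp_neg, hθ]
      have h2 : W / (W + a j) = (a j / W + 1)⁻¹ := by field_simp; ring
      simp only [h2]
      exact inv_anti₀ (by have := ha0 j; positivity) (Real.add_one_le_exp _)
    refine le_trans ?_ (Finset.prod_le_prod (fun j _ => (Real.exp_pos _).le) fun j _ => h1 j)
    rw [← Real.exp_sum, Real.exp_le_exp, Finset.sum_neg_distrib, neg_le_neg_iff,
      ← Finset.sum_div, div_le_iff₀ hW0]
    exact (Finset.sum_le_sum_of_subset_of_nonneg (Finset.erase_subset _ _)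
      fun i _ _ => ha0 i).trans hsum
  have hfin : volume (convexHull ℝ (Set.range q) ∩ {x | g x ≤ 0}) ≠ ⊤ :=
    ((measure_mono Set.inter_subset_left).trans_lt
      ((Set.finite_range q).isCompact_convexHull ℝ).measure_lt_top).ne
  calc _ ≤ (∏ j ∈ Finset.univ.erase m, θ j) * volume.real (convexHull ℝ (Set.range q)) := by gcongr
    _ = volume.real (convexHull ℝ (Set.range y)) := by
        rw [measureReal_def, measureReal_def, hvol, ENNReal.toReal_mul,
          ENNReal.toReal_ofReal (Finset.prod_nonneg fun j _ => hθ0 j)]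
    _ ≤ _ := measureReal_mono hsub hfin

namespace NBCS

variable {d : ℕ}

theorem measureReal_simplex_pos
    (b : AffineBasis (Fin (d + 1)) ℝ (EuclideanSpace ℝ (Fin d))) :
    0 < volume.real (convexHull ℝ (Set.range b)) :=
  ENNReal.toReal_pos
    (Measure.measure_pos_of_nonempty_interior _ ⟨_, b.centroid_mem_interior_convexHull⟩).ne'
    ((Set.finite_range _).isCompact_convexHull ℝ).measure_lt_top.ne

/-- When only a tiny part of the simplex has to be cut off, a single halfspace does: a convex set
of small volume misses some point deep inside the simplex. -/
theorem exists_weight_zero_stages {q : Fin (d + 1) → EuclideanSpace ℝ (Fin d)}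
    (b : AffineBasis (Fin (d + 1)) ℝ (EuclideanSpace ℝ (Fin d))) (hb : ⇑b = q)
    {P : Set (EuclideanSpace ℝ (Fin d))} (hP : IsCompact P) (hPc : Convex ℝ P)
    (hPS : P ⊆ convexHull ℝ (Set.range q)) {ε : ℝ}
    (hε : 1 - ε < Real.exp (-(2 * ((d : ℝ) + 1)))) :
    ∃ w : Fin (uniformSubdivision q 0).size → ℝ,
      volume.real ((uniformSubdivision q 0).region (convexHull ℝ (Set.range q)) w \ P) <
        ε * volume.real (convexHull ℝ (Set.range q)) ∧
      P ⊆ (uniformSubdivision q 0).region (convexHull ℝ (Set.range q)) w := by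
  set S := convexHull ℝ (Set.range q) with hS
  have hSc : IsCompact S := (Set.finite_range _).isCompact_convexHull ℝ
  have hSpos : 0 < volume.real S := by rw [hS, ← hb]; exact measureReal_simplex_pos b
  by_cases hvP : volume.real P ≤ (1 - ε) * volume.real S
  swap
  · refine ⟨0, ?_, fun x hx => ⟨hPS hx, by simp⟩⟩
    have h1 : (uniformSubdivision q 0).region S 0 = S := by
      ext x; simp [region]
    rw [h1, measureReal_sdiff hPS hP.measurableSet hSc.measure_lt_top.ne]
    push Not at hvP
    linarith
  set c := ∑ i, ((d : ℝ) + 1)⁻¹ • q i with hc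
  -- not all vertices of the half-size copy of the simplex lie in `P`
  obtain ⟨j, hj⟩ : ∃ j, AffineMap.homothety c (2⁻¹ : ℝ) (q j) ∉ P := by
    by_contra! hcon
    have h1 : AffineMap.homothety c (2⁻¹ : ℝ) '' S ⊆ P := by
      rw [hS, AffineMap.image_convexHull]
      refine convexHull_min ?_ hPc
      rintro _ ⟨_, ⟨j, rfl⟩, rfl⟩
      exact hcon j
    have h2 := measureReal_mono (μ := volume) h1 hP.measure_lt_top.ne
    rw [measureReal_def, Measure.addHaar_image_homothety, ENNReal.toReal_mul,
      finrank_euclideanSpace_fin, ENNReal.toReal_ofReal (abs_nonneg _),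
      abs_of_nonneg (by positivity), ← measureReal_def] at h2
    have h3 : Real.exp (-(2 * ((d : ℝ) + 1))) ≤ 2⁻¹ ^ d := by
      have h4 : Real.exp (-1) ≤ 2⁻¹ := by
        rw [Real.exp_neg]
        exact inv_anti₀ two_pos (by have := Real.add_one_le_exp (1 : ℝ); linarith)
      calc Real.exp (-(2 * ((d : ℝ) + 1))) ≤ Real.exp (d * (-1)) := by
            rw [Real.exp_le_exp]
            have : (0 : ℝ) ≤ d := Nat.cast_nonneg d
            linarith
        _ = Real.exp (-1) ^ d := Real.exp_nat_mul _ _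
        _ ≤ 2⁻¹ ^ d := by gcongr
    have h5 : (1 - ε) * volume.real S < 2⁻¹ ^ d * volume.real S :=
      mul_lt_mul_of_pos_right (hε.trans_le h3) hSpos
    linarith
  set x := AffineMap.homothety c (2⁻¹ : ℝ) (q j) with hx
  obtain ⟨f, u, v, hfx, huv, hfP⟩ := geometric_hahn_banach_compact_closed
    (convex_singleton x) isCompact_singleton hPc hP.isClosed (Set.disjoint_singleton_left.2 hj)
  have hfx := hfx x rfl
  let g : EuclideanSpace ℝ (Fin d) →ᵃ[ℝ] ℝ := f.toLinearMap.toAffineMap - AffineMap.const ℝ _ u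
  have hg : ∀ y, g y = f y - u := fun y => rfl
  -- the barycentric coefficients of `x`
  set l : Fin (d + 1) → ℝ := fun i => (2 * ((d : ℝ) + 1))⁻¹ + if i = j then 2⁻¹ else 0 with hl
  have hl1 : ∑ i, l i = 1 := by
    simp only [hl, Finset.sum_add_distrib, Finset.sum_ite_eq', Finset.mem_univ, if_true,
      Finset.sum_const, Finset.card_univ, Fintype.card_fin, nsmul_eq_mul]
    push_cast
    field_simp
    norm_num
  have hlx : ∑ i, l i • q i = x := by
    have h1 : ∀ i, l i • q i = (2⁻¹ : ℝ) • (((d : ℝ) + 1)⁻¹ • q i) +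
        if i = j then (2⁻¹ : ℝ) • q i else 0 := fun i => by
      simp only [hl, add_smul, ite_smul, zero_smul, smul_smul, mul_inv]
    simp only [h1, Finset.sum_add_distrib, Finset.sum_ite_eq', Finset.mem_univ, if_true]
    rw [← Finset.smul_sum, ← hc, hx, AffineMap.homothety_eq_lineMap, AffineMap.lineMap_apply_module]
    norm_num
  have hgx : ∑ i, l i * g (q i) < 0 := by
    have h1 := g.map_sum_smul q hl1
    simp only [smul_eq_mul] at h1
    rw [← h1, hlx, hg]
    linarith
  have hhalf := exp_mul_measure_le_measure_halfspace q g hl1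
    (fun i => by simp only [hl]; split_ifs <;> norm_num) hgx
  have hB := valid_uniformSubdivision q 0
  set w : Fin (uniformSubdivision q 0).size → ℝ :=
    fun k => f ((uniformSubdivision q 0).pt k) - v with hw
  have hdot : ∀ y ∈ S, w ⬝ᵥ (uniformSubdivision q 0).embed y = f y - v := by
    intro y hy
    obtain ⟨σ, hσ, α, -, h1, h2, h3⟩ := exists_dotProduct_embed hB
      (exists_mem_hull_uniformSubdivision q 0 hy) w
    rw [h3, ← h2, map_sum]
    simp only [hw, mul_sub, Finset.sum_sub_distrib, ← Finset.sum_mul, h1, one_mul, map_smul,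
      smul_eq_mul]
  refine ⟨w, ?_, ?_⟩
  · have hsub : (uniformSubdivision q 0).region S w \ P ⊆ S \ (S ∩ {x | g x ≤ 0}) := by
      rintro y ⟨⟨hyS, hy⟩, -⟩
      rw [hdot y hyS] at hy
      refine ⟨hyS, fun h => ?_⟩
      have h1 : g y ≤ 0 := h.2
      rw [hg] at h1
      linarith
    have hmeas : MeasurableSet (S ∩ {x | g x ≤ 0}) := by
      simp only [hg]
      exact (hSc.isClosed.inter (isClosed_le (by fun_prop) continuous_const)).measurableSet
    have h1 := measureReal_mono (μ := volume) hsub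
      ((measure_mono Set.sdiff_subset).trans_lt hSc.measure_lt_top).ne
    rw [measureReal_sdiff Set.inter_subset_left hmeas hSc.measure_lt_top.ne] at h1
    have h2 := mul_lt_mul_of_pos_right hε hSpos
    linarith
  · intro y hy
    refine ⟨hPS hy, ?_⟩
    rw [hdot y (hPS hy)]
    linarith [hfP y hy]

end NBCS

/-! ### The number of stages -/

/-- Choice of the resolution `n` and the number `s` of stages that make the error terms small. -/
theorem exists_stages_resolution {A D η : ℝ} (hA : 1 ≤ A) (hD : 2 ≤ D) (hη0 : 0 < η)
    (hη1 : η ≤ 1) :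
    ∃ s n : ℕ, n ≠ 0 ∧ (s : ℝ) ≤ D ^ 2 / 2 * Real.log (20 * A * D ^ 2 / η ^ 2) + 1 ∧
      A / n + n * ((1 - 2 / D ^ 2) ^ s * D ^ 2) < η := by
  have hD0 : 0 < D := by linarith
  set n : ℕ := ⌈4 * A / η⌉₊ with hn
  have hn1 : 4 * A / η ≤ n := Nat.le_ceil _
  have hn0 : (0 : ℝ) < n := lt_of_lt_of_le (by positivity) hn1
  have hn2 : (n : ℝ) ≤ 5 * A / η := by
    have h1 : (n : ℝ) < 4 * A / η + 1 := Nat.ceil_lt_add_one (by positivity)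
    have h2 : 1 ≤ A / η := by rw [le_div_iff₀ hη0]; linarith
    have h3 : 5 * A / η = 4 * A / η + A / η := by ring
    linarith
  set Y := Real.log (4 * n * D ^ 2 / η) with hY
  have hYle : Y ≤ Real.log (20 * A * D ^ 2 / η ^ 2) := by
    refine Real.log_le_log (by positivity) ?_
    calc 4 * n * D ^ 2 / η ≤ 4 * (5 * A / η) * D ^ 2 / η := by gcongr
      _ = 20 * A * D ^ 2 / η ^ 2 := by field_simp; norm_num
  have hY0 : 0 ≤ Y := by
    refine Real.log_nonneg ?_
    rw [le_div_iff₀ hη0, one_mul]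
    have h1 : (4 : ℝ) ≤ n := by
      refine le_trans ?_ hn1
      rw [le_div_iff₀ hη0]
      linarith
    nlinarith
  refine ⟨⌈D ^ 2 / 2 * Y⌉₊, n, by exact_mod_cast hn0.ne', ?_, ?_⟩
  · refine (Nat.ceil_lt_add_one (by positivity)).le.trans ?_
    gcongr
  · have h1 : A / n ≤ η / 4 := by
      rw [div_le_iff₀ hn0]
      rw [div_le_iff₀ hη0] at hn1
      linarith
    have h2 : (1 - 2 / D ^ 2) ^ ⌈D ^ 2 / 2 * Y⌉₊ ≤ η / (4 * n * D ^ 2) := by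
      have h3 : 0 ≤ 1 - 2 / D ^ 2 := by
        rw [sub_nonneg, div_le_one (by positivity)]
        nlinarith
      calc (1 - 2 / D ^ 2) ^ ⌈D ^ 2 / 2 * Y⌉₊
          ≤ Real.exp (-(2 / D ^ 2)) ^ ⌈D ^ 2 / 2 * Y⌉₊ := by
            gcongr
            linarith [Real.add_one_le_exp (-(2 / D ^ 2))]
        _ = Real.exp (⌈D ^ 2 / 2 * Y⌉₊ * -(2 / D ^ 2)) := (Real.exp_nat_mul _ _).symm
        _ ≤ Real.exp (-Y) := by
            rw [Real.exp_le_exp, mul_neg, neg_le_neg_iff]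
            calc Y = D ^ 2 / 2 * Y * (2 / D ^ 2) := by field_simp
              _ ≤ ⌈D ^ 2 / 2 * Y⌉₊ * (2 / D ^ 2) := by gcongr; exact Nat.le_ceil _
        _ = η / (4 * n * D ^ 2) := by
            rw [Real.exp_neg, hY, Real.exp_log (by positivity), inv_div]
    have h3 : n * ((1 - 2 / D ^ 2) ^ ⌈D ^ 2 / 2 * Y⌉₊ * D ^ 2) ≤ η / 4 := by
      calc n * ((1 - 2 / D ^ 2) ^ ⌈D ^ 2 / 2 * Y⌉₊ * D ^ 2)
          ≤ n * (η / (4 * n * D ^ 2) * D ^ 2) := by gcongr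
        _ = η / 4 := by field_simp
    linarith

/-- A bound for the constant of `measure_shell_le`. -/
theorem shell_constant_le (d : ℕ) :
    2 * (d + 1) * (2 * (d + 1) ^ 2 + 1) ^ d ≤ 2 ^ (1 + 3 * d + 2 * d ^ 2) := by
  have h1 : d + 1 ≤ 2 ^ d := Nat.lt_two_pow_self
  have h2 : 2 * (d + 1) ^ 2 + 1 ≤ 2 ^ (2 + 2 * d) := by
    calc 2 * (d + 1) ^ 2 + 1 ≤ 4 * (d + 1) ^ 2 := by nlinarith
      _ ≤ 4 * (2 ^ d) ^ 2 := by gcongr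
      _ = 2 ^ (2 + 2 * d) := by rw [pow_add, mul_comm 2 d, pow_mul]; norm_num
  calc 2 * (d + 1) * (2 * (d + 1) ^ 2 + 1) ^ d ≤ 2 * 2 ^ d * (2 ^ (2 + 2 * d)) ^ d := by gcongr
    _ = 2 ^ (1 + 3 * d + 2 * d ^ 2) := by rw [← pow_mul]; ring

/-- The logarithm that governs the number of stages, for the error `ε ^ d / 2`. -/
theorem log_stage_term_le {d : ℕ} (hd : d ≠ 0) {ε A : ℝ} (hε : 0 < ε) (hA0 : 0 < A)
    (hA : A ≤ 2 ^ (1 + 3 * d + 2 * d ^ 2)) :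
    Real.log (20 * A * ((d : ℝ) + 1) ^ 2 / (ε ^ d / 2) ^ 2) ≤
      15 * d ^ 2 + 2 * d * Real.log (1 / ε) := by
  have hdN : 1 ≤ d := Nat.one_le_iff_ne_zero.2 hd
  have h1 : 20 * A * ((d : ℝ) + 1) ^ 2 / (ε ^ d / 2) ^ 2 ≤
      2 ^ (15 * d ^ 2) * (1 / ε) ^ (2 * d) := by
    have h2 : (d : ℝ) + 1 ≤ 2 ^ d := by exact_mod_cast (Nat.lt_two_pow_self : d < 2 ^ d)
    have h3 : 20 * A * ((d : ℝ) + 1) ^ 2 / (ε ^ d / 2) ^ 2 =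
        80 * A * ((d : ℝ) + 1) ^ 2 * (1 / ε) ^ (2 * d) := by
      rw [mul_comm 2 d, pow_mul, one_div, inv_pow, inv_pow]
      field_simp
      norm_num
    rw [h3]
    gcongr
    calc 80 * A * ((d : ℝ) + 1) ^ 2
        ≤ 2 ^ 7 * 2 ^ (1 + 3 * d + 2 * d ^ 2) * (2 ^ d) ^ 2 := by
          gcongr
          norm_num
      _ = 2 ^ (8 + 5 * d + 2 * d ^ 2) := by
          rw [← pow_mul, ← pow_add, ← pow_add]
          congr 1
          ring
      _ ≤ 2 ^ (15 * d ^ 2) := pow_le_pow_right₀ one_le_two (by nlinarith)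
  calc _ ≤ Real.log (2 ^ (15 * d ^ 2) * (1 / ε) ^ (2 * d)) :=
        Real.log_le_log (by positivity) h1
    _ = 15 * d ^ 2 * Real.log 2 + 2 * d * Real.log (1 / ε) := by
        rw [Real.log_mul (by positivity) (by positivity), Real.log_pow, Real.log_pow]
        push_cast
        ring
    _ ≤ 15 * d ^ 2 * 1 + 2 * d * Real.log (1 / ε) := by
        gcongr
        linarith [Real.log_two_lt_d9]
    _ = _ := by ring

/-- If `ε` is not exponentially close to `1`, then `ln (1 / ε)` is at least exponentially small in
`d`. -/
theorem one_le_two_pow_mul_log {d : ℕ} (hd : d ≠ 0) {ε : ℝ} (hε0 : 0 < ε)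
    (hε : Real.exp (-(2 * ((d : ℝ) + 1))) ≤ 1 - ε) :
    1 ≤ 2 ^ (8 * d) * Real.log (1 / ε) := by
  have hd1 : (1 : ℝ) ≤ d := by exact_mod_cast Nat.one_le_iff_ne_zero.2 hd
  have h1 : 1 - ε ≤ Real.log (1 / ε) := by
    rw [one_div, Real.log_inv]
    linarith [Real.log_le_sub_one_of_pos hε0]
  have h2 : Real.exp (2 * ((d : ℝ) + 1)) ≤ 2 ^ (8 * d) := by
    have h3 : Real.exp 1 ≤ 2 ^ 2 := by linarith [Real.exp_one_lt_d9]
    calc Real.exp (2 * ((d : ℝ) + 1)) ≤ Real.exp ((4 * d : ℕ) * 1) := by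
          rw [Real.exp_le_exp]; push_cast; linarith
      _ = Real.exp 1 ^ (4 * d) := Real.exp_nat_mul _ _
      _ ≤ (2 ^ 2) ^ (4 * d) := by gcongr
      _ = 2 ^ (8 * d) := by rw [← pow_mul]; congr 1; ring
  calc (1 : ℝ) = Real.exp (2 * ((d : ℝ) + 1)) * Real.exp (-(2 * ((d : ℝ) + 1))) := by
        rw [← Real.exp_add, add_neg_cancel, Real.exp_zero]
    _ ≤ 2 ^ (8 * d) * Real.log (1 / ε) :=
        mul_le_mul h2 (hε.trans h1) (Real.exp_pos _).le (by positivity)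

/-- A constant and a linear term in `L` are absorbed by `2 ^ (C d) * L²` when `L ≥ 2 ^ (-8 d)`. -/
theorem quartic_mul_le {d : ℕ} (hd : d ≠ 0) {L : ℝ} (hL0 : 0 < L) (hL : 1 ≤ 2 ^ (8 * d) * L) :
    32 * (d : ℝ) ^ 4 * (1 + L) ≤ 2 ^ (26 * d) * L ^ 2 := by
  have hdN : 1 ≤ d := Nat.one_le_iff_ne_zero.2 hd
  have h4 : (d : ℝ) ^ 4 ≤ 2 ^ (4 * d) := by
    have : (d : ℝ) ≤ 2 ^ d := by exact_mod_cast (Nat.lt_two_pow_self : d < 2 ^ d).le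
    calc (d : ℝ) ^ 4 ≤ (2 ^ d) ^ 4 := by gcongr
      _ = 2 ^ (4 * d) := by rw [← pow_mul, mul_comm]
  have h8 : (1 : ℝ) ≤ 2 ^ (8 * d) := one_le_pow₀ one_le_two
  have h9 : 1 + L ≤ 2 * (2 ^ (8 * d) * L) ^ 2 := by
    nlinarith [mul_le_mul_of_nonneg_right h8 hL0.le]
  have h10 : (32 : ℝ) ≤ 2 ^ (5 * d) := by
    calc (32 : ℝ) = 2 ^ 5 := by norm_num
      _ ≤ _ := pow_le_pow_right₀ one_le_two (by omega)
  have h11 : (2 : ℝ) ≤ 2 ^ d := by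
    calc (2 : ℝ) = 2 ^ 1 := by norm_num
      _ ≤ _ := pow_le_pow_right₀ one_le_two hdN
  calc 32 * (d : ℝ) ^ 4 * (1 + L)
      ≤ 2 ^ (5 * d) * 2 ^ (4 * d) * (2 ^ d * (2 ^ (8 * d) * L) ^ 2) := by
        refine mul_le_mul (mul_le_mul h10 h4 (by positivity) (by positivity))
          (h9.trans (by gcongr)) (by positivity) (by positivity)
    _ = 2 ^ (26 * d) * L ^ 2 := by
        rw [mul_pow, ← pow_mul, ← mul_assoc, ← mul_assoc, ← pow_add, ← pow_add, ← pow_add]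
        congr 2
        ring

/-- Stages within the required bound make both error terms together smaller than `ε ^ d / 2`. -/
theorem exists_stage_count {d : ℕ} (hd : d ≠ 0) {ε : ℝ} (hε0 : 0 < ε) (hε1 : ε < 1)
    (hε : Real.exp (-(2 * ((d : ℝ) + 1))) ≤ 1 - ε) :
    ∃ s n : ℕ, n ≠ 0 ∧ ((s + 1 : ℕ) : ℝ) ≤ 2 ^ (26 * d) * Real.log (1 / ε) ^ 2 ∧
      ((2 * (d + 1) * (2 * (d + 1) ^ 2 + 1) ^ d : ℕ) : ℝ) / n +
        n * ((1 - 2 / ((d : ℝ) + 1) ^ 2) ^ s * ((d : ℝ) + 1) ^ 2) < ε ^ d / 2 := by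
  have hd1 : (1 : ℝ) ≤ d := by exact_mod_cast Nat.one_le_iff_ne_zero.2 hd
  have hη1 : ε ^ d / 2 ≤ 1 := by
    have : ε ^ d ≤ 1 := pow_le_one₀ hε0.le hε1.le
    linarith
  have hA1 : (1 : ℝ) ≤ (2 * (d + 1) * (2 * (d + 1) ^ 2 + 1) ^ d : ℕ) := by
    exact_mod_cast Nat.one_le_iff_ne_zero.2 (by positivity)
  have hA : ((2 * (d + 1) * (2 * (d + 1) ^ 2 + 1) ^ d : ℕ) : ℝ) ≤
      2 ^ (1 + 3 * d + 2 * d ^ 2) := by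
    exact_mod_cast shell_constant_le d
  obtain ⟨s, n, hn, hs, herr⟩ := exists_stages_resolution hA1
    (show (2 : ℝ) ≤ d + 1 by linarith) (show 0 < ε ^ d / 2 by positivity) hη1
  refine ⟨s, n, hn, ?_, herr⟩
  have hlog := log_stage_term_le hd hε0 (by linarith) hA
  have hL8 := one_le_two_pow_mul_log hd hε0 hε
  set L := Real.log (1 / ε)
  have hL0 : 0 < L := Real.log_pos (by rwa [one_div, one_lt_inv₀ hε0])
  refine le_trans ?_ (quartic_mul_le hd hL0 hL8)
  have h2 : ((d : ℝ) + 1) ^ 2 / 2 ≤ 2 * d ^ 2 := by nlinarith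
  have h3 := mul_le_mul h2 hlog (Real.log_nonneg ?_) (by positivity)
  · have h5 : (1 : ℝ) ≤ d ^ 4 := one_le_pow₀ hd1
    have h6 : (d : ℝ) ^ 3 * L ≤ d ^ 4 * L :=
      mul_le_mul_of_nonneg_right (pow_le_pow_right₀ hd1 (by norm_num)) hL0.le
    have h9 : 2 * (d : ℝ) ^ 2 * (15 * d ^ 2 + 2 * d * L) = 30 * d ^ 4 + 4 * (d ^ 3 * L) := by ring
    have h10 : 0 ≤ (d : ℝ) ^ 4 * L := by positivity
    have h11 : 32 * (d : ℝ) ^ 4 * (1 + L) = 32 * d ^ 4 + 32 * (d ^ 4 * L) := by ring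
    push_cast
    linarith
  · have h7 : (ε ^ d / 2) ^ 2 ≤ 1 := pow_le_one₀ (by positivity) hη1
    rw [one_le_div (by positivity)]
    nlinarith


/-! ### The approximation theorem -/

/-- For weights of sum zero, the squared norm of the weighted sum of the vertices of a regular
simplex is half the sum of the squares of the weights. -/
theorem affineIndependent_of_dist_eq_one {ι E : Type*} [Fintype ι] [NormedAddCommGroup E]
    [InnerProductSpace ℝ E] {q : ι → E} (hq : ∀ i j, i ≠ j → dist (q i) (q j) = 1) :
    AffineIndependent ℝ q := by
  classical
  rw [affineIndependent_iff_of_fintype]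
  intro w hw h0
  have h := EuclideanGeometry.inner_weightedVSub q hw q hw
  rw [h0, inner_zero_left] at h
  have h1 : ∀ i j, w i * w j * (dist (q i) (q j) * dist (q i) (q j)) =
      w i * w j - if i = j then w i * w j else 0 := fun i j => by
    by_cases hij : i = j
    · simp [hij]
    · simp [hij, hq i j hij]
  have h3 : ∑ i, ∑ j, w i * w j = 0 := by
    rw [← Finset.sum_mul_sum, hw, zero_mul]
  simp only [h1, Finset.sum_sub_distrib, Finset.sum_ite_eq, Finset.mem_univ, if_true, h3] at h
  have h2 : ∑ i, w i * w i = 0 := by linarith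
  intro i
  exact mul_self_eq_zero.1
    ((Finset.sum_eq_zero_iff_of_nonneg fun i _ => mul_self_nonneg (w i)).1 h2 i (Finset.mem_univ i))

theorem theorem2 :
    ∃ C : ℕ, ∀ (d : ℕ) (q : Fin (d + 1) → EuclideanSpace ℝ (Fin d)),
      (∀ i j, i ≠ j → dist (q i) (q j) = 1) →
      ∀ (P : ConvexBody (EuclideanSpace ℝ (Fin d))),
      (P : Set (EuclideanSpace ℝ (Fin d))) ⊆ convexHull ℝ (Set.range q) →
      Metric.diam (P : Set (EuclideanSpace ℝ (Fin d))) = 1 →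
      ∀ ε : ℝ, 0 < ε → ε < 1 →
      ∃ (s : ℕ) (B : NBCS d) (w : Fin B.size → ℝ),
        (s : ℝ) ≤ 2 ^ (C * d) * Real.log (1 / ε) ^ 2 ∧
        B = NBCS.uniformSubdivision q s ∧ B.IsNested q ∧
        volume (B.region (convexHull ℝ (Set.range q)) w \ P) <
          ENNReal.ofReal ε * volume (convexHull ℝ (Set.range q)) ∧
        innerParallel (B.region (convexHull ℝ (Set.range q)) w) ε ⊆ P ∧
        (P : Set (EuclideanSpace ℝ (Fin d))) ⊆ B.region (convexHull ℝ (Set.range q)) w := by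
  refine ⟨26, fun d q hq P hPS hdiam ε hε0 hε1 => ?_⟩
  -- in dimension `0` no set has diameter `1`
  have hd : d ≠ 0 := by
    rintro rfl
    rw [Metric.diam_subsingleton Set.subsingleton_of_subsingleton] at hdiam
    exact zero_ne_one hdiam
  have hind := affineIndependent_of_dist_eq_one hq
  let b : AffineBasis (Fin (d + 1)) ℝ (EuclideanSpace ℝ (Fin d)) :=
    ⟨q, hind, hind.affineSpan_eq_top_iff_card_eq_finrank_add_one.2 (by simp)⟩
  have hb : ⇑b = q := rfl
  set S := convexHull ℝ (Set.range q) with hS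
  have hSc : IsCompact S := (Set.finite_range q).isCompact_convexHull ℝ
  have hSpos : 0 < volume.real S := NBCS.measureReal_simplex_pos b
  -- passage from real-valued to extended volumes
  have hlift : ∀ {X : Set (EuclideanSpace ℝ (Fin d))} {r : ℝ}, X ⊆ S → 0 ≤ r →
      volume.real X < r * volume.real S → volume X < ENNReal.ofReal r * volume S := by
    intro X r hX hr h
    have hfin : volume X ≠ ⊤ := ((measure_mono hX).trans_lt hSc.measure_lt_top).ne
    rw [← ENNReal.toReal_lt_toReal hfin
      (ENNReal.mul_ne_top ENNReal.ofReal_ne_top hSc.measure_lt_top.ne), ENNReal.toReal_mul,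
      ENNReal.toReal_ofReal hr]
    exact h
  have hregion : ∀ (B : NBCS d) (w : Fin B.size → ℝ), B.region S w ⊆ S := fun B w x hx => hx.1
  have hdist : ∀ i j, dist (q i) (q j) ≤ 1 := fun i j => by
    by_cases h : i = j
    · simp [h]
    · exact (hq i j h).le
  by_cases hε : 1 - ε < Real.exp (-(2 * ((d : ℝ) + 1)))
  · obtain ⟨w, h1, h2⟩ := NBCS.exists_weight_zero_stages b hb P.isCompact P.convex hPS hε
    refine ⟨0, _, w, by simpa using by positivity, rfl, NBCS.isNested_uniformSubdivision q 0,
      hlift (Set.sdiff_subset.trans (hregion _ _)) hε0.le h1, ?_, h2⟩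
    rw [innerParallel_eq_empty_of_diam_lt hd (hregion _ _) hSc.isBounded hε0.le]
    · exact Set.empty_subset _
    · have h3 : Metric.diam S ≤ 1 := by
        rw [hS, convexHull_diam]
        refine Metric.diam_le_of_forall_dist_le zero_le_one ?_
        rintro _ ⟨i, rfl⟩ _ ⟨j, rfl⟩
        exact hdist i j
      have h4 : Real.exp (-(2 * ((d : ℝ) + 1))) < 2⁻¹ := by
        rw [Real.exp_neg]
        refine inv_strictAnti₀ two_pos ?_
        have : (0 : ℝ) ≤ d := Nat.cast_nonneg d
        linarith [Real.add_one_le_exp (2 * ((d : ℝ) + 1))]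
      norm_num at h4
      linarith
  · obtain ⟨s, n, hn, hs, herr⟩ := exists_stage_count hd hε0 hε1 (not_lt.1 hε)
    have hBv := NBCS.valid_uniformSubdivision q (s + 1)
    have hm := NBCS.measure_region_missWeight_diff_le b hb hd P.isCompact P.convex hPS s hn
    have hm' := hlift (Set.sdiff_subset.trans (hregion _ _)) (by positivity)
      (hm.trans_lt (mul_lt_mul_of_pos_right herr hSpos))
    refine ⟨s + 1, _, (NBCS.uniformSubdivision q (s + 1)).missWeight P, hs, rfl,
      NBCS.isNested_uniformSubdivision q (s + 1), hm'.trans_le ?_, ?_, ?_⟩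
    · gcongr
      have h1 : ε ^ d ≤ ε := pow_le_of_le_one hε0.le hε1.le hd
      have h2 : 0 < ε ^ d := by positivity
      linarith
    · refine innerParallel_subset_of_measure_lt (z := q 0) P.isClosed P.convex hε0 ?_ hm'
      refine convexHull_min ?_ (convex_closedBall _ _)
      rintro _ ⟨i, rfl⟩
      exact hdist i 0
    · exact NBCS.subset_region_missWeight hBv hPS
        fun x hx => NBCS.exists_mem_hull_uniformSubdivision q (s + 1) hx
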